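/- Let $X$ be a compact connected Riemann surface with canonical bundle $K$, and let $Q$ be a quiver with finite vertex set $V(Q)$ and edge set $E(Q)$; write $t(a), h(a)$ for the tail and head of an edge $a$. A $\overline{Q}$-bundle $(\mathcal E,\phi,x,y)$ on $X$ (a bundle on the double quiver $\overline Q$) consists of * a holomorphic vector bundle $\mathcal E_v$ on $X$ of finite rank $r_v\ge 0$, for every $v\in V(Q)$; * a smooth $\mathrm{End}(\mathcal E_v)$-valued $(1,0)$-form $\phi_v\in\Omega^{1,0}(X,\mathrm{End}(\mathcal E_v))$, for every $v\in V(Q)$; * for every $a\in E(Q)$ a holomorphic bundle morphism $x_a:\mathcal E_{t(a)}\to\mathcal E_{h(a)}$; * for every $a\in E(Q)$ (i.e. for the reversed edge) a smooth $\mathrm{Hom}(\mathcal E_{h(a)},\mathcal E_{t(a)})$-valued $(1,1)$-form $y_a$ (a Dolbeault representative of an element of $H^1(X,\mathrm{Hom}(\mathcal E_{h(a)},\mathcal E_{t(a)})\otimes K)\cong \mathrm{Hom}(\mathcal E_{t(a)},\mathcal E_{h(a)})^*$). An endomorphism of $(\mathcal E,\phi,x,y)$ is a family $f=(f_v)_{v}$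 of holomorphic bundle endomorphisms $f_v:\mathcal E_v\to\mathcal E_v$ such that $f_v\phi_v=\phi_vf_v$ for all $v$, and $f_{h(a)}x_a=x_af_{t(a)}$, $f_{t(a)}y_a=y_af_{h(a)}$ for all $a$, as identities of forms. The $\overline Q$-bundle is simple if each of its endomorphisms is scalar: there is one $c\in\mathbb C$ with $f_v=c\cdot\mathrm{id}_{\mathcal E_v}$ for all $v$. A $\overline{Q}$-subbundle is a family $\mathcal E'=(\mathcal E'_v)_v$ of holomorphic subbundles $\mathcal E'_v\subseteq\mathcal E_v$ with $\phi_v(\mathcal E'_v)\subseteq\mathcal E'_v\otimes\Lambda^{1,0}$, $x_a(\mathcal E'_{t(a)})\subseteq\mathcal E'_{h(a)}$ and $y_a(\mathcal E'_{h(a)})\subseteq\mathcal E'_{t(a)}\otimes\Lambda^{1,1}$. For real numbers $\sigma_v>0$ and $\tau_v$ ($v\in V(Q)$) let $$\mu_{\sigma,\tau}(\mathcal E')=\frac{\sum_{v}\sigma_v\deg(\mathcal E'_v)+\sum_v\tau_v\operatorname{rk}(\mathcal E'_v)}{\sum_v\operatorname{rk}(\mathcal E'_v)},$$ and call $(\mathcal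 E,\phi,x,y)$ stable (with respect to $\sigma,\tau$) if $\mu_{\sigma,\tau}(\mathcal E')<\mu_{\sigma,\tau}(\mathcal E)$ for every $\overline Q$-subbundle $\mathcal E'$ with $0\ne\mathcal E'\ne\mathcal E$. **Proposition.** For all real $\sigma_v>0$ and $\tau_v$: if $(\mathcal E,\phi,x,y)$ is stable, then it is simple, i.e. its only endomorphisms are the scalar multiples of the identity. -/

import Mathlib

open Bundle Manifold
open scoped Manifold ContDiff Laplacian InnerProductSpace

noncomputable section

namespace QbarBundle

universe u w

/-! ### Complex-analytic and real-smooth structures -/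

/-- A Riemann surface is a smooth real surface. -/
theorem isManifold_real (X : Type*) [TopologicalSpace X] [ChartedSpace ℂ X]
    [IsManifold 𝓘(ℂ, ℂ) ω X] : IsManifold 𝓘(ℝ, ℂ) ∞ X := by
  apply isManifold_of_contDiffOn
  intro e e' he he'
  have h := (contDiffGroupoid ω 𝓘(ℂ, ℂ)).compatible (M := X) he he'
  rw [contDiffGroupoid, mem_groupoid_of_pregroupoid] at h
  exact (ContDiffOn.restrict_scalars ℝ h.1).of_le (by simp)

/-- Complex-analytic maps on a complex manifold are real smooth. -/
theorem contMDiffOn_real {E H M F : Type*} [NormedAddCommGroup E] [NormedSpace ℂ E]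
    [NormedAddCommGroup F] [NormedSpace ℂ F] [TopologicalSpace M]
    [TopologicalSpace H] {I : ModelWithCorners ℂ E H} {J : ModelWithCorners ℝ E H}
    (hIJ : (I : H → E) = J) (hIJ' : (I.symm : E → H) = J.symm) [ChartedSpace H M]
    {f : M → F} {s : Set M} (hf : ContMDiffOn I 𝓘(ℂ, F) ω f s) :
    ContMDiffOn J 𝓘(ℝ, F) ∞ f s := by
  intro x hx
  have h := hf x hx
  rw [contMDiffWithinAt_iff] at h ⊢
  refine ⟨h.1, ?_⟩
  have h2 := (ContDiffWithinAt.restrict_scalars ℝ h.2).of_le (m := ∞) (by simp)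
  simpa [extChartAt, hIJ, hIJ', Function.comp_def] using h2

section Bundle

variable {X : Type u} [TopologicalSpace X] [ChartedSpace ℂ X]

/-- The model for a holomorphic vector bundle of rank `r` over a Riemann surface. -/
abbrev modelC (r : ℕ) := 𝓘(ℂ, ℂ).prod 𝓘(ℂ, Fin r → ℂ)

/-- The same model, regarded over the real numbers. -/
abbrev modelR (r : ℕ) := 𝓘(ℝ, ℂ).prod 𝓘(ℝ, Fin r → ℂ)

/-! ### Morphisms of bundles -/

/-- A family of linear maps between the fibres of two bundles. -/
abbrev FibreMap (E E' : X → Type w) [∀ p, AddCommGroup (E p)] [∀ p, Module ℂ (E p)]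
    [∀ p, AddCommGroup (E' p)] [∀ p, Module ℂ (E' p)] :=
  ∀ p, E p →ₗ[ℂ] E' p

section Morphisms

variable {r r' : ℕ} {E E' : X → Type w}
  [∀ p, AddCommGroup (E p)] [∀ p, Module ℂ (E p)] [∀ p, TopologicalSpace (E p)]
  [TopologicalSpace (TotalSpace (Fin r → ℂ) E)] [FiberBundle (Fin r → ℂ) E]
  [∀ p, AddCommGroup (E' p)] [∀ p, Module ℂ (E' p)] [∀ p, TopologicalSpace (E' p)]
  [TopologicalSpace (TotalSpace (Fin r' → ℂ) E')] [FiberBundle (Fin r' → ℂ) E']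

/-- The map of total spaces defined by a family of linear maps between the fibres. -/
def FibreMap.total (r r' : ℕ) (T : FibreMap E E') :
    TotalSpace (Fin r → ℂ) E → TotalSpace (Fin r' → ℂ) E' :=
  fun e => ⟨e.1, T e.1 e.2⟩

variable (r r') in
/-- `T` is a holomorphic morphism of vector bundles. -/
def IsHolomorphicMap (T : FibreMap E E') : Prop :=
  ContMDiff (modelC r) (modelC r') ω (T.total r r')

variable (r r') in
/-- `T` is a smooth morphism of complex vector bundles over the set `U`. -/
def IsSmoothMapOn (T : FibreMap E E') (U : Set X) : Prop :=
  ContMDiffOn (modelR r) (modelR r') ∞ (T.total r r') {e | e.1 ∈ U}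

variable [IsManifold 𝓘(ℂ, ℂ) ω X]

/-- The holomorphic coordinate vector field `∂/∂z` on the domain of the chart at `c`. -/
def coordField (c q : X) : TangentSpace 𝓘(ℂ, ℂ) q :=
  (trivializationAt ℂ (TangentSpace 𝓘(ℂ, ℂ) : X → Type) c).symm q 1

/-- A family of `Hom(E, E')`-valued `(1,0)`-covectors: at each point a *complex linear* map from the
tangent line to `Hom(E_p, E'_p)`. -/
abbrev OneForm (E E' : X → Type w) [∀ p, AddCommGroup (E p)] [∀ p, Module ℂ (E p)]
    [∀ p, AddCommGroup (E' p)] [∀ p, Module ℂ (E' p)] :=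
  ∀ p : X, TangentSpace 𝓘(ℂ, ℂ) p →ₗ[ℂ] (E p →ₗ[ℂ] E' p)

/-- A family of `Hom(E, E')`-valued `2`-covectors: at each point a real bilinear alternating map on
the tangent line with values in `Hom(E_p, E'_p)`. On a Riemann surface all such forms are
of type `(1,1)`. -/
abbrev TwoForm (E E' : X → Type w) [∀ p, AddCommGroup (E p)] [∀ p, Module ℂ (E p)]
    [∀ p, AddCommGroup (E' p)] [∀ p, Module ℂ (E' p)] :=
  ∀ p : X, TangentSpace 𝓘(ℂ, ℂ) p [⋀^Fin 2]→ₗ[ℝ] (E p →ₗ[ℂ] E' p)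

variable (r r') in
/-- Smoothness of a `(1,0)`-form: in each chart, writing it as `A dz`, the coefficient `A` is a
smooth bundle morphism. -/
def OneForm.IsSmooth (φ : OneForm E E') : Prop :=
  ∀ c : X, IsSmoothMapOn r r' (fun q => φ q (coordField c q)) (chartAt ℂ c).source

variable (r r') in
/-- Smoothness of a `2`-form: in each chart with coordinate `z = s + i t`, writing it as `B ds ∧ dt`,
the coefficient `B` is a smooth bundle morphism. -/
def TwoForm.IsSmooth (y : TwoForm E E') : Prop :=
  ∀ c : X, IsSmoothMapOn r r'
    (fun q => y q ![coordField c q, Complex.I • coordField c q]) (chartAt ℂ c).source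

end Morphisms

/-! ### Hermitian metrics, holomorphic subbundles and their degree -/

section Degree

variable {r : ℕ} {E : X → Type w}
  [∀ p, AddCommGroup (E p)] [∀ p, Module ℂ (E p)] [∀ p, TopologicalSpace (E p)]
  [TopologicalSpace (TotalSpace (Fin r → ℂ) E)] [FiberBundle (Fin r → ℂ) E]

variable (r E) in
/-- A smooth hermitian metric on a complex vector bundle: a hermitian inner product on every fibre,
whose associated squared norm is a smooth function on the total space. -/
structure HermitianMetric where
  /-- the inner product on the fibre over `p` -/
  core : ∀ p, InnerProductSpace.Core ℂ (E p)
  smooth : ContMDiff (modelR r) 𝓘(ℝ, ℝ) ∞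
    (fun e : TotalSpace (Fin r → ℂ) E => ((core e.1).inner e.2 e.2).re)

variable (r) in
/-- The section `s` of `E` is holomorphic on `U`. -/
def IsHolomorphicSectionOn (s : ∀ p, E p) (U : Set X) : Prop :=
  ContMDiffOn 𝓘(ℂ, ℂ) (modelC r) ω (fun q => (⟨q, s q⟩ : TotalSpace (Fin r → ℂ) E)) U

variable (r) in
/-- `s₁, …, s_k` is a holomorphic frame, over the open set `U`, of the family of subspaces `S`. -/
structure IsHolomorphicFrameOn {k : ℕ} (S : ∀ p, Submodule ℂ (E p)) (s : Fin k → ∀ p, E p)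
    (U : Set X) : Prop where
  isOpen : IsOpen U
  holomorphic : ∀ a, IsHolomorphicSectionOn r (s a) U
  linearIndependent : ∀ q ∈ U, LinearIndependent ℂ (fun a => s a q)
  span_eq : ∀ q ∈ U, Submodule.span ℂ (Set.range fun a => s a q) = S q

variable (r E) in
/-- A holomorphic subbundle of `E`: a family of subspaces of the fibres, of constant dimension,
which is locally spanned by a holomorphic frame. -/
structure HolomorphicSubbundle where
  /-- the fibre of the subbundle over `p` -/
  fibre : ∀ p, Submodule ℂ (E p)
  /-- the rank of the subbundle -/
  rank : ℕ
  exists_frame : ∀ p, ∃ (U : Set X) (s : Fin rank → ∀ q, E q),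
    p ∈ U ∧ IsHolomorphicFrameOn r fibre s U

variable (r E) in
/-- A holomorphic vector bundle as a subbundle of itself. -/
def HolomorphicSubbundle.whole [VectorBundle ℂ (Fin r → ℂ) E]
    [ContMDiffVectorBundle ω (Fin r → ℂ) E 𝓘(ℂ, ℂ)] : HolomorphicSubbundle r E where
  fibre := fun _ => ⊤
  rank := r
  exists_frame := fun p => by
    let e := trivializationAt (Fin r → ℂ) E p
    let b := Pi.basisFun ℂ (Fin r)
    have h := e.isLocalFrameOn_localFrame_baseSet 𝓘(ℂ, ℂ) ω b
    exact ⟨e.baseSet, e.localFrame b, mem_baseSet_trivializationAt _ _ _, e.open_baseSet,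
      h.contMDiffOn, fun q hq => h.linearIndependent hq,
      fun q hq => top_le_iff.1 (h.generating hq)⟩

/-- A holomorphic frame of the subbundle near the point `p`. -/
def HolomorphicSubbundle.frame (S : HolomorphicSubbundle r E) (p : X) :
    Fin S.rank → ∀ q, E q :=
  (S.exists_frame p).choose_spec.choose

/-- For sections `s₁, …, s_k` of `E`, the function `log det (⟨s_a, s_b⟩)`. -/
def HermitianMetric.logGram (H : HermitianMetric r E) {k : ℕ} (s : Fin k → ∀ q, E q) (q : X) : ℝ :=
  Real.log (Matrix.det (Matrix.of fun a b => (H.core q).inner (s a q) (s b q))).re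

/-- Let `S` carry the metric induced by `H`, and let `F` be the curvature of its Chern connection.
If `s` is a local holomorphic frame of `S`, then `tr F = ∂̄∂ log det (⟨s_a, s_b⟩)`. Hence
in a holomorphic chart with coordinate `z = s + i t` the Chern form `(i / 2π) tr F` is the `2`-form
`-(1 / 4π) Δ (log det (⟨s_a, s_b⟩)) ds ∧ dt`, which does not depend on the frame. This is
its coefficient in the chart at `c`, at the point with coordinate `z`. -/
def HermitianMetric.chernDensity (H : HermitianMetric r E) (S : HolomorphicSubbundle r E) (c : X)
    (z : ℂ) : ℝ :=
  -(1 / (4 * Real.pi)) *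
    (Δ (fun z' : ℂ => H.logGram (S.frame ((chartAt ℂ c).symm z)) ((chartAt ℂ c).symm z'))) z

section Existence

variable [VectorBundle ℂ (Fin r → ℂ) E] [ContMDiffVectorBundle ω (Fin r → ℂ) E 𝓘(ℂ, ℂ)]
  [IsManifold 𝓘(ℂ, ℂ) ω X] [CompactSpace X] [T2Space X]

variable (X) in
theorem exists_partition : ∃ f : SmoothPartitionOfUnity X 𝓘(ℝ, ℂ) X Set.univ,
    f.IsSubordinate (fun x => (chartAt ℂ x).source) :=
  have := isManifold_real X
  SmoothPartitionOfUnity.exists_isSubordinate_chartAt_source 𝓘(ℝ, ℂ) X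

variable (X) in
/-- A smooth partition of unity on the compact Riemann surface `X` subordinate to its charts. -/
def partition : SmoothPartitionOfUnity X 𝓘(ℝ, ℂ) X Set.univ := (exists_partition X).choose

/-- The integral over `X` of a `2`-form, given by its coefficients `f c` in the charts at the
points `c` of `X`. -/
def surfaceIntegral (f : X → ℂ → ℝ) : ℝ :=
  ∑ᶠ c : X, ∫ z in (chartAt ℂ c).target, partition X c ((chartAt ℂ c).symm z) * f c z

variable (r E) in
/-- Every holomorphic vector bundle on a compact Riemann surface has a hermitian metric. -/
theorem nonempty_hermitianMetric : Nonempty (HermitianMetric r E) := by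
  classical
  have := isManifold_real X
  let τ : X → Trivialization (Fin r → ℂ) (π (Fin r → ℂ) E) :=
    fun i => trivializationAt (Fin r → ℂ) E i
  obtain ⟨f, hf⟩ := SmoothPartitionOfUnity.exists_isSubordinate 𝓘(ℝ, ℂ) (s := (Set.univ : Set X))
    isClosed_univ (fun i => (τ i).baseSet) (fun i => (τ i).open_baseSet)
    (fun x _ => Set.mem_iUnion_of_mem x (mem_baseSet_trivializationAt _ _ _))
  have hfin : {i | (Function.support (f i)).Nonempty}.Finite :=
    f.locallyFinite.finite_nonempty_of_compact
  let I : Finset X := hfin.toFinset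
  have hpos : ∀ p, ∃ i ∈ I, 0 < f i p := by
    intro p
    obtain ⟨i, hi⟩ := f.exists_pos_of_mem (Set.mem_univ p)
    exact ⟨i, hfin.mem_toFinset.2 ⟨p, hi.ne'⟩, hi⟩
  let g : ∀ (i p : X), E p → Fin r → ℂ := fun i p => (τ i).linearMapAt ℂ p
  let h : ∀ p, E p → E p → ℂ :=
    fun p u v => ∑ i ∈ I, (f i p : ℂ) * ∑ k, (starRingEnd ℂ) (g i p u k) * g i p v k
  have hre : ∀ p u, (h p u u).re = ∑ i ∈ I, f i p * ∑ k, Complex.normSq (g i p u k) := by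
    intro p u
    simp only [h, Complex.re_sum, ← Complex.normSq_eq_conj_mul_self, ← Complex.ofReal_sum,
      Complex.re_ofReal_mul, Complex.ofReal_re]
  have hnn : ∀ p u i, 0 ≤ f i p * ∑ k, Complex.normSq (g i p u k) := fun p u i =>
    mul_nonneg (f.nonneg i p) (Finset.sum_nonneg fun k _ => Complex.normSq_nonneg _)
  refine ⟨⟨fun p =>
    { inner := h p
      conj_inner_symm := ?_
      re_inner_nonneg := ?_
      add_left := ?_
      smul_left := ?_
      definite := ?_ }, ?_⟩⟩
  · intro u v
    simp only [h, map_sum, map_mul, Complex.conj_ofReal, Complex.conj_conj]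
    exact Finset.sum_congr rfl fun i _ => by
      congr 1
      exact Finset.sum_congr rfl fun k _ => mul_comm _ _
  · intro u
    change 0 ≤ (h p u u).re
    rw [hre]
    exact Finset.sum_nonneg fun i _ => hnn p u i
  · intro u v z
    simp only [h, g, map_add, Pi.add_apply, add_mul, Finset.sum_add_distrib, mul_add]
  · intro u v c
    simp only [h, g, map_smul, Pi.smul_apply, smul_eq_mul, map_mul, Finset.mul_sum]
    exact Finset.sum_congr rfl fun i _ => Finset.sum_congr rfl fun k _ => by ring
  · intro u hu
    have hu' : (h p u u).re = 0 := by
      change h p u u = 0 at hu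
      rw [hu]; rfl
    rw [hre, Finset.sum_eq_zero_iff_of_nonneg fun i _ => hnn p u i] at hu'
    obtain ⟨i, hi, hip⟩ := hpos p
    have h1 := (mul_eq_zero.1 (hu' i hi)).resolve_left hip.ne'
    rw [Finset.sum_eq_zero_iff_of_nonneg fun k _ => Complex.normSq_nonneg _] at h1
    have hb : p ∈ (τ i).baseSet := hf i (subset_tsupport _ hip.ne')
    have h2 : g i p u = 0 := funext fun k => Complex.normSq_eq_zero.1 (h1 k (Finset.mem_univ k))
    have h3 : (τ i).linearEquivAt ℂ p hb u = 0 := by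
      rw [← h2]
      simp only [g, (τ i).coe_linearMapAt_of_mem hb]
      rfl
    exact ((τ i).linearEquivAt ℂ p hb).map_eq_zero_iff.1 h3
  · change ContMDiff (modelR r) 𝓘(ℝ, ℝ) ∞
      (fun e : TotalSpace (Fin r → ℂ) E => (h e.1 e.2 e.2).re)
    simp only [hre]
    refine contMDiff_finsetSum fun i _ => ?_
    intro e
    by_cases he : e.1 ∈ tsupport (f i)
    · have hb : e.1 ∈ (τ i).baseSet := hf i he
      have hs : (τ i).source ∈ nhds e := (τ i).open_source.mem_nhds ((τ i).mem_source.2 hb)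
      have h1 : ContMDiffOn (modelC r) 𝓘(ℂ, Fin r → ℂ) ω
          (fun e : TotalSpace (Fin r → ℂ) E => (τ i e).2) (τ i).source :=
        contMDiff_snd.comp_contMDiffOn ((τ i).contMDiffOn (IB := 𝓘(ℂ, ℂ)) (n := ω))
      have h2 : ContMDiffAt (modelR r) 𝓘(ℝ, Fin r → ℂ) ∞
          (fun e : TotalSpace (Fin r → ℂ) E => (τ i e).2) e :=
        (contMDiffOn_real (J := modelR r) rfl rfl h1).contMDiffAt hs
      have h3 : ContMDiffAt (modelR r) 𝓘(ℝ, ℝ) ∞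
          (fun e : TotalSpace (Fin r → ℂ) E => ∑ k, Complex.normSq ((τ i e).2 k)) e := by
        have hc : ContDiff ℝ ∞ (fun w : Fin r → ℂ => ∑ k, Complex.normSq (w k)) := by
          simp only [Complex.normSq_eq_norm_sq]
          exact ContDiff.sum fun k _ => (contDiff_apply ℝ ℂ k).norm_sq ℝ
        exact hc.contMDiff.contMDiffAt.comp e h2
      have h4 : ContMDiffAt (modelR r) 𝓘(ℝ, ℝ) ∞
          (fun e : TotalSpace (Fin r → ℂ) E => f i e.1) e :=
        ((f i).contMDiff.comp (contMDiff_proj E)).contMDiffAt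
      refine (h4.mul h3).congr_of_eventuallyEq ?_
      filter_upwards [hs] with e' he'
      have hb' := (τ i).mem_source.1 he'
      simp only [g, (τ i).coe_linearMapAt_of_mem hb', Pi.mul_apply]
    · have hz : ∀ᶠ e' : TotalSpace (Fin r → ℂ) E in nhds e, e'.1 ∉ tsupport (f i) :=
        (FiberBundle.continuous_proj (Fin r → ℂ) E).continuousAt.eventually
          ((isClosed_tsupport _).isOpen_compl.mem_nhds he)
      refine (contMDiffAt_const (c := (0 : ℝ))).congr_of_eventuallyEq ?_
      filter_upwards [hz] with e' he'
      simp [image_eq_zero_of_notMem_tsupport he']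

/-- The degree of a holomorphic subbundle: the integral over `X` of its first Chern form
`(i / 2π) tr F`. It does not depend on the metric. -/
def HolomorphicSubbundle.degree (S : HolomorphicSubbundle r E) : ℝ :=
  surfaceIntegral ((nonempty_hermitianMetric r E).some.chernDensity S)

end Existence

end Degree

end Bundle

/-! ### Bundles on double quivers -/

section Quiver

variable {X : Type u} [TopologicalSpace X] [ChartedSpace ℂ X] [IsManifold 𝓘(ℂ, ℂ) ω X]
  {V : Type*} [Quiver V]

section Defs

variable (r : V → ℕ) (E : V → X → Type w)
  [∀ v p, AddCommGroup (E v p)] [∀ v p, Module ℂ (E v p)] [∀ v p, TopologicalSpace (E v p)]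
  [∀ v, TopologicalSpace (TotalSpace (Fin (r v) → ℂ) (E v))]
  [∀ v, FiberBundle (Fin (r v) → ℂ) (E v)]

/-- The data `(φ, x, y)` making the family of holomorphic vector bundles `E v` into a bundle on the
double of the quiver `V`: smooth `End(E_v)`-valued `(1,0)`-forms `φ_v`; for every arrow
`a : i ⟶ j` a holomorphic morphism `x_a : E_i → E_j`; and for its reverse a smooth
`Hom(E_j, E_i)`-valued `(1,1)`-form `y_a`. -/
structure Rep where
  φ : ∀ v, OneForm (E v) (E v)
  φ_smooth : ∀ v, (φ v).IsSmooth (r v) (r v)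
  x : ∀ {i j : V}, (i ⟶ j) → FibreMap (E i) (E j)
  x_holomorphic : ∀ {i j : V} (a : i ⟶ j), IsHolomorphicMap (r i) (r j) (x a)
  y : ∀ {i j : V}, (i ⟶ j) → TwoForm (E j) (E i)
  y_smooth : ∀ {i j : V} (a : i ⟶ j), (y a).IsSmooth (r j) (r i)

end Defs

variable {r r' : V → ℕ} {E E' : V → X → Type w}
  [∀ v p, AddCommGroup (E v p)] [∀ v p, Module ℂ (E v p)] [∀ v p, TopologicalSpace (E v p)]
  [∀ v, TopologicalSpace (TotalSpace (Fin (r v) → ℂ) (E v))]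
  [∀ v, FiberBundle (Fin (r v) → ℂ) (E v)]
  [∀ v p, AddCommGroup (E' v p)] [∀ v p, Module ℂ (E' v p)] [∀ v p, TopologicalSpace (E' v p)]
  [∀ v, TopologicalSpace (TotalSpace (Fin (r' v) → ℂ) (E' v))]
  [∀ v, FiberBundle (Fin (r' v) → ℂ) (E' v)]

/-- A morphism of bundles on the double quiver: a family of holomorphic bundle morphisms commuting
with `φ`, `x` and `y`. -/
structure IsMorphism (R : Rep r E) (R' : Rep r' E') (f : ∀ v, FibreMap (E v) (E' v)) : Prop where
  holomorphic : ∀ v, IsHolomorphicMap (r v) (r' v) (f v)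
  comm_φ : ∀ v p (t : TangentSpace 𝓘(ℂ, ℂ) p), f v p ∘ₗ R.φ v p t = R'.φ v p t ∘ₗ f v p
  comm_x : ∀ {i j : V} (a : i ⟶ j) p, f j p ∘ₗ R.x a p = R'.x a p ∘ₗ f i p
  comm_y : ∀ {i j : V} (a : i ⟶ j) p (t : Fin 2 → TangentSpace 𝓘(ℂ, ℂ) p),
    f i p ∘ₗ R.y a p t = R'.y a p t ∘ₗ f j p

/-- `R` is simple: its only endomorphisms are the scalar multiples of the identity. -/
def Rep.IsSimple (R : Rep r E) : Prop :=
  ∀ f : ∀ v, FibreMap (E v) (E v), IsMorphism R R f →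
    ∃ c : ℂ, ∀ v p, f v p = c • (LinearMap.id : E v p →ₗ[ℂ] E v p)

/-- The holomorphic subbundles `S_v ⊆ E_v` form a subbundle on the double quiver: `φ`, `x` and `y`
restrict to them. -/
structure Rep.IsSubbundle (R : Rep r E) (S : ∀ v, HolomorphicSubbundle (r v) (E v)) : Prop where
  map_φ : ∀ v p (t : TangentSpace 𝓘(ℂ, ℂ) p), (S v).fibre p ≤ ((S v).fibre p).comap (R.φ v p t)
  map_x : ∀ {i j : V} (a : i ⟶ j) p, (S i).fibre p ≤ ((S j).fibre p).comap (R.x a p)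
  map_y : ∀ {i j : V} (a : i ⟶ j) p (t : Fin 2 → TangentSpace 𝓘(ℂ, ℂ) p),
    (S j).fibre p ≤ ((S i).fibre p).comap (R.y a p t)

variable [Fintype V] [∀ v, VectorBundle ℂ (Fin (r v) → ℂ) (E v)]
  [∀ v, ContMDiffVectorBundle ω (Fin (r v) → ℂ) (E v) 𝓘(ℂ, ℂ)] [CompactSpace X] [T2Space X]

/-- The `(σ, τ)`-slope `(∑ σ_v deg S_v + ∑ τ_v rk S_v) / ∑ rk S_v`. -/
def slope (σ τ : V → ℝ) (S : ∀ v, HolomorphicSubbundle (r v) (E v)) : ℝ :=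
  (∑ v, σ v * (S v).degree + ∑ v, τ v * ((S v).rank : ℝ)) / ∑ v, ((S v).rank : ℝ)

/-- `R` is `(σ, τ)`-stable: every nonzero proper subbundle has slope less than that of the bundle. -/
def Rep.IsStable (R : Rep r E) (σ τ : V → ℝ) : Prop :=
  ∀ S : ∀ v, HolomorphicSubbundle (r v) (E v), R.IsSubbundle S →
    (∃ v p, (S v).fibre p ≠ ⊥) → (∃ v p, (S v).fibre p ≠ ⊤) →
      slope σ τ S < slope σ τ (fun v => HolomorphicSubbundle.whole (r v) (E v))

end Quiver

end QbarBundle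

end

open Filter Topology MeasureTheory
open scoped ComplexOrder

namespace QbarBundle

/-! ### The Laplacian in the complex plane -/

/-! A non-scalar endomorphism f would yield two subbundles that cannot both have slope below μ(E).
Choose an eigenvalue c of f at one point of one bundle of positive rank, and put g = f - c·id. At
that vertex det g is a holomorphic function on a compact connected surface with a zero, hence is
identically zero, so g has a kernel at every point (`ker_ne_bot_of_ker_ne_bot`). If g ≠ 0, its
kernel and image, saturated to subbundles S and I, are invariant under φ, x, y, and both are nonzero
and proper. Since rk S_v + rk I_v = r_v and deg E_v ≤ deg S_v + deg I_v at each vertex, positivity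
of σ makes one of the two slopes at least μ(E) (`not_slope_lt_and_slope_lt`), against stability.

Saturation rests on a one-variable Smith normal form (`exists_smithForm`): near a point g is
diagonal, with entries powers of z - z₀ and zeros, from a frame (v, u) of E to independent sections
w; then u frames S and w frames I. The fibres of S and I are also described intrinsically, through
values of continuous sections (`satFibre`), so their invariance uses no more than continuity of φ, x
and y.

For the degree inequality (`degree_whole_le`), g induces a generically invertible map E/S → I. The
squared norm u of its determinant is smooth and nonnegative on X with finitely many zeros, and off
them -(1/4π) Δ log u is the Chern density of S plus that of I minus that of E. Its integral counts
zeros, but only the sign matters. For ε > 0 the function log(u + ε) is smooth on X, so its Laplacian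
integrates to zero, while Δ log(u + ε) ≥ u/(u + ε) · Δ log u where u > 0 (`laplacian_log_add_ge`).
Letting ε tend to 0 gives the inequality by dominated convergence, without any local analysis at the
zeros. The integral of a Laplacian makes sense on X because Δf ds∧dt is conformally invariant. -/

theorem laplacian_eq_fderiv_fderiv (f : ℂ → ℝ) (z : ℂ) :
    Δ f z = fderiv ℝ (fderiv ℝ f) z 1 1 + fderiv ℝ (fderiv ℝ f) z Complex.I Complex.I := by
  rw [InnerProductSpace.laplacian_eq_iteratedFDeriv_complexPlane]
  simp [iteratedFDeriv_two_apply]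

theorem continuousAt_laplacian {f : ℂ → ℝ} {z : ℂ} (hf : ContDiffAt ℝ 2 f z) :
    ContinuousAt (Δ f) z := by
  have h : Δ f = fun w => fderiv ℝ (fderiv ℝ f) w 1 1
      + fderiv ℝ (fderiv ℝ f) w Complex.I Complex.I :=
    funext (laplacian_eq_fderiv_fderiv f)
  have h1 : ContDiffAt ℝ 1 (fderiv ℝ f) z := hf.fderiv_right (by norm_num)
  have h2 : ContDiffAt ℝ 0 (fderiv ℝ (fderiv ℝ f)) z := h1.fderiv_right (by norm_num)
  have h3 := h2.continuousAt
  rw [h]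
  fun_prop

theorem fderiv_real_eq_deriv_mul {h : ℂ → ℂ} {z : ℂ} (hh : DifferentiableAt ℂ h z) (v : ℂ) :
    fderiv ℝ h z v = deriv h z * v := by
  rw [hh.fderiv_restrictScalars ℝ]
  simp [mul_comm]

/-- The Laplacian is conformally covariant. -/
theorem laplacian_comp_holomorphic {F : ℂ → ℝ} {h : ℂ → ℂ} {z : ℂ}
    (hF : ContDiffAt ℝ 2 F (h z)) (hh : AnalyticAt ℂ h z) :
    Δ (F ∘ h) z = ‖deriv h z‖ ^ 2 * Δ F (h z) := by
  have hd : ∀ᶠ w in 𝓝 z, ∀ v, fderiv ℝ (F ∘ h) w v = fderiv ℝ F (h w) (deriv h w * v) := by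
    filter_upwards [hh.continuousAt.eventually (hF.eventually (by simp)),
      hh.eventually_analyticAt] with w hw hw' v
    rw [fderiv_comp w (hw.differentiableAt (by simp))
      (hw'.differentiableAt.restrictScalars ℝ)]
    simp [fderiv_real_eq_deriv_mul hw'.differentiableAt]
  have hF1 : DifferentiableAt ℝ (fderiv ℝ F) (h z) :=
    (hF.fderiv_right (m := 1) (by norm_num)).differentiableAt (by simp)
  have hFh : ContDiffAt ℝ 2 (F ∘ h) z :=
    hF.comp z ((hh.contDiffAt (n := 2)).restrict_scalars ℝ)
  have hFh1 : DifferentiableAt ℝ (fderiv ℝ (F ∘ h)) z :=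
    (hFh.fderiv_right (m := 1) (by norm_num)).differentiableAt (by simp)
  have hhd : DifferentiableAt ℝ h z := hh.differentiableAt.restrictScalars ℝ
  have key : ∀ v, fderiv ℝ (fderiv ℝ (F ∘ h)) z v v =
      fderiv ℝ (fderiv ℝ F) (h z) (deriv h z * v) (deriv h z * v)
        + fderiv ℝ F (h z) (deriv (deriv h) z * v * v) := by
    intro v
    have e1 : fderiv ℝ (fun w => fderiv ℝ (F ∘ h) w v) z v
        = fderiv ℝ (fderiv ℝ (F ∘ h)) z v v := by
      rw [fderiv_clm_apply hFh1 (differentiableAt_const _)]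
      simp
    rw [← e1]
    have e2 : (fun w => fderiv ℝ (F ∘ h) w v) =ᶠ[𝓝 z]
        fun w => (fderiv ℝ F ∘ h) w (deriv h w * v) := by
      filter_upwards [hd] with w hw using hw v
    have hdh : DifferentiableAt ℝ (fun w => deriv h w * v) z :=
      (hh.deriv.differentiableAt.mul_const v).restrictScalars ℝ
    rw [e2.fderiv_eq, fderiv_clm_apply (hF1.comp z hhd) hdh, fderiv_comp z hF1 hhd]
    have e3 : fderiv ℝ (fun w => deriv h w * v) z v = deriv (deriv h) z * v * v := by
      rw [fderiv_real_eq_deriv_mul (hh.deriv.differentiableAt.mul_const v),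
        deriv_mul_const hh.deriv.differentiableAt]
    simp [e3, fderiv_real_eq_deriv_mul hh.differentiableAt, add_comm]
  rw [laplacian_eq_fderiv_fderiv, laplacian_eq_fderiv_fderiv, key, key]
  generalize fderiv ℝ (fderiv ℝ F) (h z) = B
  generalize deriv (deriv h) z = d2
  -- The terms in h'' cancel between the directions 1 and I, since 1² + I² = 0.
  have hI : d2 * Complex.I * Complex.I = -(d2 * 1 * 1) := by
    rw [mul_assoc, Complex.I_mul_I]; ring
  rw [hI, map_neg]
  have hsplit : ∀ w : ℂ, w = w.re • (1 : ℂ) + w.im • Complex.I := fun w => by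
    simp [Complex.re_add_im]
  -- Symmetry of B is not needed: the mixed terms enter only through their sum, which cancels
  -- between w = h' and w = h' · I.
  have hB : ∀ w : ℂ, B w w = w.re ^ 2 * B 1 1 + w.re * w.im * (B 1 Complex.I + B Complex.I 1)
      + w.im ^ 2 * B Complex.I Complex.I := by
    intro w
    conv_lhs => rw [hsplit w]
    simp only [map_add, map_smul, add_apply, smul_apply, smul_eq_mul]
    ring
  rw [hB (deriv h z * 1), hB (deriv h z * Complex.I), ← Complex.normSq_eq_norm_sq,
    Complex.normSq_apply]
  simp
  ring

/-- Were the second derivative negative, the second derivative test would make the point a local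
maximum as well; g would then be locally constant, with second derivative 0. -/
theorem deriv_deriv_nonneg_of_isLocalMin {g : ℝ → ℝ} {t : ℝ} (hg : ContinuousAt g t)
    (hm : IsLocalMin g t) : 0 ≤ deriv (deriv g) t := by
  by_contra! hlt
  have hM := isLocalMax_of_deriv_deriv_neg hlt hm.deriv_eq_zero hg
  have hc : g =ᶠ[𝓝 t] fun _ => g t := by
    filter_upwards [hm, hM] with s h1 h2 using le_antisymm h2 h1
  have h0 : deriv (deriv g) t = 0 := by
    rw [hc.deriv.deriv_eq]; simp
  linarith

/-- The restrictions to the real lines through z in the directions 1 and I have a local minimum, and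
the Laplacian is the sum of their second derivatives. -/
theorem laplacian_nonneg_of_isLocalMin {f : ℂ → ℝ} {z : ℂ} (hf : ContDiffAt ℝ 2 f z)
    (hm : IsLocalMin f z) : 0 ≤ Δ f z := by
  rw [laplacian_eq_fderiv_fderiv]
  have key : ∀ v : ℂ, 0 ≤ fderiv ℝ (fderiv ℝ f) z v v := by
    intro v
    let l : ℝ → ℂ := fun t => z + t • v
    have hl : ∀ t, HasDerivAt l v t := fun t => by
      simpa [l] using ((hasDerivAt_id t).smul_const v).const_add z
    have hl0 : l 0 = z := by simp [l]
    have hlc : ContinuousAt l 0 := (hl 0).continuousAt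
    have hev : ∀ᶠ t in 𝓝 (0 : ℝ), ContDiffAt ℝ 2 f (l t) :=
      hlc.eventually (by rw [hl0]; exact hf.eventually (by simp))
    have hd : deriv (f ∘ l) =ᶠ[𝓝 0] fun t => fderiv ℝ f (l t) v := by
      filter_upwards [hev] with t ht
      exact ((ht.differentiableAt (by simp)).hasFDerivAt.comp_hasDerivAt t (hl t)).deriv
    have hf1 : DifferentiableAt ℝ (fderiv ℝ f) (l 0) := by
      rw [hl0]
      exact (hf.fderiv_right (m := 1) (by norm_num)).differentiableAt (by simp)
    have hdd : deriv (deriv (f ∘ l)) 0 = fderiv ℝ (fderiv ℝ f) z v v := by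
      rw [hd.deriv_eq]
      have h1 := hf1.hasFDerivAt.comp_hasDerivAt 0 (hl 0)
      have h2 := h1.clm_apply (hasDerivAt_const (0 : ℝ) v)
      rw [hl0] at h2
      simpa using h2.deriv
    rw [← hdd]
    apply deriv_deriv_nonneg_of_isLocalMin
    · exact ContinuousAt.comp (by rw [hl0]; exact hf.continuousAt) hlc
    · have h : ∀ᶠ w in 𝓝 (l 0), f z ≤ f w := by rw [hl0]; exact hm
      filter_upwards [hlc.eventually h] with t ht
      simpa [hl0] using ht
  exact add_nonneg (key _) (key _)

/-- The function s ↦ log(eˢ + ε) is convex, with slope u₀/(u₀ + ε) at s = log u₀; this is its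
tangent line inequality. It comes from concavity of log at the points u/u₀ and 1, with weights
u₀/(u₀ + ε) and ε/(u₀ + ε). -/
theorem log_add_ge {u u₀ ε : ℝ} (hu : 0 < u) (hu₀ : 0 < u₀) (hε : 0 < ε) :
    Real.log (u₀ + ε) + u₀ / (u₀ + ε) * (Real.log u - Real.log u₀) ≤ Real.log (u + ε) := by
  have hs : 0 < u₀ + ε := by positivity
  have hc := strictConcaveOn_log_Ioi.concaveOn.2 
    (show u / u₀ ∈ Set.Ioi 0 from Set.mem_Ioi.2 (div_pos hu hu₀))
    (show (1 : ℝ) ∈ Set.Ioi 0 from Set.mem_Ioi.2 one_pos)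
    (show 0 ≤ u₀ / (u₀ + ε) by positivity) (show 0 ≤ ε / (u₀ + ε) by positivity) (by field_simp)
  have e : u₀ / (u₀ + ε) * (u / u₀) + ε / (u₀ + ε) * 1 = (u + ε) / (u₀ + ε) := by field_simp
  simp only [smul_eq_mul, Real.log_one, mul_zero, add_zero] at hc
  rw [e, Real.log_div hu.ne' hu₀.ne', Real.log_div (by positivity) hs.ne'] at hc
  linarith

/-- With the coefficient frozen at z, `log_add_ge` says that log(u + ε) minus a constant multiple of
log u has a local minimum at z. This gives the comparison without computing any gradient term. -/
theorem laplacian_log_add_ge {u : ℂ → ℝ} {z : ℂ} {ε : ℝ} (hε : 0 < ε) (hu : ContDiffAt ℝ 2 u z)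
    (h0 : 0 < u z) :
    u z / (u z + ε) * Δ (fun w => Real.log (u w)) z ≤ Δ (fun w => Real.log (u w + ε)) z := by
  have h1 : ContDiffAt ℝ 2 (fun w => Real.log (u w)) z := hu.log h0.ne'
  have h2 : ContDiffAt ℝ 2 (fun w => Real.log (u w + ε)) z :=
    (hu.add contDiffAt_const).log (by positivity)
  have h3 : ContDiffAt ℝ 2 ((u z / (u z + ε)) • fun w => Real.log (u w)) z :=
    contDiffAt_const.smul h1
  have hm : IsLocalMin ((fun w => Real.log (u w + ε)) -
      (u z / (u z + ε)) • fun w => Real.log (u w)) z := by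
    filter_upwards [hu.continuousAt.eventually (lt_mem_nhds h0)] with w hw
    have := log_add_ge hw h0 hε
    simp only [Pi.sub_apply, Pi.smul_apply, smul_eq_mul]
    linarith
  have h4 := laplacian_nonneg_of_isLocalMin (ContDiffAt.sub h2 h3) hm
  change 0 ≤ Δ ((fun w => Real.log (u w + ε)) - (u z / (u z + ε)) • fun w => Real.log (u w)) z at h4
  rw [h2.laplacian_sub h3, InnerProductSpace.laplacian_smul _ h1] at h4
  simpa using h4

/-! ### Integrals of Laplacians in the plane. -/

theorem integral_laplacian_eq_zero {f : ℂ → ℝ} (hf : ContDiff ℝ 2 f) (hc : HasCompactSupport f) :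
    ∫ z, Δ f z = 0 := by
  have hf1 : ContDiff ℝ 1 (fderiv ℝ f) := hf.fderiv_right (by norm_num)
  have hf2 : Continuous (fderiv ℝ (fderiv ℝ f)) :=
    (hf1.fderiv_right (m := 0) (by norm_num)).continuous
  have hc1 : HasCompactSupport (fderiv ℝ f) := hc.fderiv (𝕜 := ℝ)
  have hc2 : HasCompactSupport (fderiv ℝ (fderiv ℝ f)) := hc1.fderiv (𝕜 := ℝ)
  have hint : ∀ v : ℂ, Integrable (fun z => fderiv ℝ (fderiv ℝ f) z v v) := fun v =>
    Continuous.integrable_of_hasCompactSupport (by fun_prop)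
      (hc2.comp_left (g := fun L : ℂ →L[ℝ] ℂ →L[ℝ] ℝ => L v v) (by simp))
  have key : ∀ v : ℂ, ∫ z, fderiv ℝ (fderiv ℝ f) z v v = 0 := by
    intro v
    have hd : Differentiable ℝ (fun z => fderiv ℝ f z v) := fun z =>
      ((hf1.differentiable (by simp)) z).clm_apply (differentiableAt_const _)
    have e : ∀ z, fderiv ℝ (fun z => fderiv ℝ f z v) z v = fderiv ℝ (fderiv ℝ f) z v v := by
      intro z
      rw [fderiv_clm_apply (hf1.differentiable (by simp) z) (differentiableAt_const _)]
      simp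
    -- Integration by parts against the constant function 1, whose derivative vanishes.
    have h := integral_mul_fderiv_eq_neg_fderiv_mul_of_integrable (μ := volume) (𝕜 := ℝ)
      (f := fun _ : ℂ => (1 : ℝ)) (g := fun z => fderiv ℝ f z v) (v := v) (by simp)
      (by simpa [e] using hint v)
      (by
        simp only [one_mul]
        exact Continuous.integrable_of_hasCompactSupport (by have := hf1.continuous; fun_prop)
          (hc1.comp_left (g := fun L : ℂ →L[ℝ] ℝ => L v) (by simp)))
      (fun _ _ => by fun_prop) (fun z _ => hd z)
    simpa [e] using h
  simp only [laplacian_eq_fderiv_fderiv]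
  rw [integral_add (hint _) (hint _), key, key, add_zero]

/-- The real Jacobian |e'|² of a holomorphic change of variables is exactly the factor by which the
Laplacian changes. -/
theorem integral_target_mul_laplacian (e : OpenPartialHomeomorph ℂ ℂ)
    (he : ∀ z ∈ e.source, AnalyticAt ℂ e z) (g F : ℂ → ℝ)
    (hF : ∀ w ∈ e.target, ContDiffAt ℝ 2 F w) :
    ∫ w in e.target, g w * Δ F w = ∫ z in e.source, g (e z) * Δ (F ∘ e) z := by
  rw [integral_target_eq_integral_abs_det_fderiv_smul volume (f := e)
    (fun z hz => ((he z hz).differentiableAt.restrictScalars ℝ).hasFDerivAt)]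
  refine setIntegral_congr_fun e.open_source.measurableSet fun z hz => ?_
  have hdet : (fderiv ℝ e z).det = ‖deriv e z‖ ^ 2 := by
    rw [(he z hz).differentiableAt.fderiv_restrictScalars ℝ, ContinuousLinearMap.det]
    have := LinearMap.det_restrictScalars (R := ℝ) (f := (fderiv ℂ e z : ℂ →ₗ[ℂ] ℂ))
    rw [Algebra.norm_complex_eq] at this
    simp [Complex.normSq_eq_norm_sq] at this
    exact this
  simp only [hdet, abs_of_nonneg (sq_nonneg ‖deriv e z‖), smul_eq_mul,
    laplacian_comp_holomorphic (hF _ (e.map_source hz)) (he z hz)]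
  ring

theorem laplacian_add_harmonic {f g : ℂ → ℝ} {z : ℂ} (hf : ContDiffAt ℝ 2 f z)
    (hg : InnerProductSpace.HarmonicAt g z) : Δ (fun w => f w + g w) z = Δ f z := by
  have h := hf.laplacian_add hg.1
  rw [hg.2.eq_of_nhds] at h
  exact h.trans (add_zero _)


/-! ### The local structure of holomorphic families of linear maps in one variable -/

theorem AnalyticAt.clm_comp' {V W Z : Type*} [NormedAddCommGroup V] [NormedSpace ℂ V]
    [NormedAddCommGroup W] [NormedSpace ℂ W] [NormedAddCommGroup Z] [NormedSpace ℂ Z]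
    {A : ℂ → W →L[ℂ] Z} {B : ℂ → V →L[ℂ] W} {z : ℂ} (hA : AnalyticAt ℂ A z)
    (hB : AnalyticAt ℂ B z) : AnalyticAt ℂ (fun x => (A x).comp (B x)) z :=
  ((ContinuousLinearMap.compL ℂ V W Z).analyticAt_bilinear _).comp (hA.prod hB)

theorem AnalyticAt.clm_apply' {V W : Type*} [NormedAddCommGroup V] [NormedSpace ℂ V]
    [NormedAddCommGroup W] [NormedSpace ℂ W]
    {A : ℂ → V →L[ℂ] W} {B : ℂ → V} {z : ℂ} (hA : AnalyticAt ℂ A z)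
    (hB : AnalyticAt ℂ B z) : AnalyticAt ℂ (fun x => A x (B x)) z :=
  ((ContinuousLinearMap.id ℂ (V →L[ℂ] W)).analyticAt_bilinear _).comp (hA.prod hB)

/-- A local Smith normal form: `w` frames the saturated image and `u` the kernel. -/
structure SmithForm {V W : Type*} [NormedAddCommGroup V] [NormedSpace ℂ V]
    [NormedAddCommGroup W] [NormedSpace ℂ W] (M : ℂ → V →L[ℂ] W) (z₀ : ℂ) (k l : ℕ) where
  v : Fin k → ℂ → V
  u : Fin l → ℂ → V
  w : Fin k → ℂ → W
  a : Fin k → ℕ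
  analytic_v : ∀ i, AnalyticAt ℂ (v i) z₀
  analytic_u : ∀ i, AnalyticAt ℂ (u i) z₀
  analytic_w : ∀ i, AnalyticAt ℂ (w i) z₀
  indep : LinearIndependent ℂ (Sum.elim (fun i => v i z₀) (fun i => u i z₀))
  indep_w : LinearIndependent ℂ (fun i => w i z₀)
  map_v : ∀ᶠ z in 𝓝 z₀, ∀ i, M z (v i z) = (z - z₀) ^ a i • w i z
  map_u : ∀ᶠ z in 𝓝 z₀, ∀ i, M z (u i z) = 0

theorem linearIndependent_sumElim_cons {V : Type*} [AddCommGroup V] [Module ℂ V] {k l : ℕ} {x : V}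
    {f : Fin k → V} {g : Fin l → V} (μ : V →ₗ[ℂ] ℂ) (hx : μ x ≠ 0) (hf : ∀ i, μ (f i) = 0)
    (hg : ∀ i, μ (g i) = 0) (h : LinearIndependent ℂ (Sum.elim f g)) :
    LinearIndependent ℂ (Sum.elim (Fin.cons x f : Fin (k + 1) → V) g) := by
  rw [Fintype.linearIndependent_iff] at h ⊢
  intro c hc
  simp only [Fintype.sum_sum_type, Sum.elim_inl, Sum.elim_inr, Fin.sum_univ_succ, Fin.cons_zero,
    Fin.cons_succ] at hc
  have h0 : c (Sum.inl 0) = 0 := by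
    have := congrArg μ hc
    simpa [hf, hg, hx] using this
  have h1 := h (Sum.elim (fun i => c (Sum.inl i.succ)) (fun i => c (Sum.inr i))) (by
    simpa [h0] using hc)
  rintro (i | i)
  · refine Fin.cases h0 (fun i => ?_) i
    simpa using h1 (Sum.inl i)
  · simpa using h1 (Sum.inr i)

/-- Gaussian elimination over the discrete valuation ring of holomorphic germs, by induction on dim
V. Pulling out the largest power of z - z₀ leaves a g with g(z₀) ≠ 0, which supplies a pivot;
clearing it leaves a map between hyperplanes. -/
theorem exists_smithForm (z₀ : ℂ) (n : ℕ) : ∀ (V W : Type)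
    [NormedAddCommGroup V] [NormedSpace ℂ V] [FiniteDimensional ℂ V]
    [NormedAddCommGroup W] [NormedSpace ℂ W] [FiniteDimensional ℂ W] (M : ℂ → V →L[ℂ] W),
    Module.finrank ℂ V = n → AnalyticAt ℂ M z₀ →
    ∃ k l : ℕ, k + l = n ∧ Nonempty (SmithForm M z₀ k l) := by
  induction n with
  | zero =>
    intro V W _ _ _ _ _ _ M hV hM
    have : Subsingleton V := Module.finrank_zero_iff.1 hV
    exact ⟨0, 0, rfl, ⟨{
      v := fun i => i.elim0
      u := fun i => i.elim0
      w := fun i => i.elim0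
      a := fun i => i.elim0
      analytic_v := fun i => i.elim0
      analytic_u := fun i => i.elim0
      analytic_w := fun i => i.elim0
      indep := linearIndependent_empty_type
      indep_w := linearIndependent_empty_type
      map_v := Eventually.of_forall fun _ i => i.elim0
      map_u := Eventually.of_forall fun _ i => i.elim0 }⟩⟩
  | succ n ih =>
    intro V W _ _ _ _ _ _ M hV hM
    by_cases hord : analyticOrderAt M z₀ = ⊤
    · let b := Module.finBasisOfFinrankEq ℂ V hV
      exact ⟨0, n + 1, by simp, ⟨{
        v := fun i => i.elim0
        u := fun i _ => b i
        w := fun i => i.elim0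
        a := fun i => i.elim0
        analytic_v := fun i => i.elim0
        analytic_u := fun i => analyticAt_const
        analytic_w := fun i => i.elim0
        indep := by
          rw [← linearIndependent_equiv (Equiv.emptySum (Fin 0) (Fin (n + 1))).symm]
          exact b.linearIndependent
        indep_w := linearIndependent_empty_type
        map_v := Eventually.of_forall fun _ i => i.elim0
        map_u := by
          filter_upwards [analyticOrderAt_eq_top.1 hord] with z hz i
          simp [hz] }⟩⟩
    · obtain ⟨g, hg, hg0, hMg⟩ := hM.analyticOrderAt_ne_top.1 hord
      set m := analyticOrderNatAt M z₀
      obtain ⟨v₀, hv₀⟩ : ∃ v₀, g z₀ v₀ ≠ 0 := by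
        by_contra! h
        exact hg0 (ContinuousLinearMap.ext h)
      obtain ⟨lam, hlam⟩ := SeparatingDual.exists_eq_one (R := ℂ) hv₀
      -- The pivot is the vector v₀, with g(z₀) v₀ ≠ 0 and lam normalised to 1 there. The smaller
      -- problem lives on the kernels of μ = lam ∘ g(z₀) and of lam.
      let μ : V →L[ℂ] ℂ := lam.comp (g z₀)
      let V' := LinearMap.ker (μ : V →ₗ[ℂ] ℂ)
      let W' := LinearMap.ker (lam : W →ₗ[ℂ] ℂ)
      have hV' : Module.finrank ℂ V' = n := by
        have h1 : (μ : V →ₗ[ℂ] ℂ) ≠ 0 := fun h => by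
          have : μ v₀ = 0 := by simpa using LinearMap.congr_fun h v₀
          simp [μ, hlam] at this
        have := Module.Dual.finrank_ker_add_one_of_ne_zero (f := (μ : V →ₗ[ℂ] ℂ)) h1
        rw [hV] at this
        exact Nat.succ_injective this
      let pr : W →L[ℂ] W' :=
        (ContinuousLinearMap.id ℂ W -
          (ContinuousLinearMap.toSpanSingleton ℂ (g z₀ v₀)).comp lam).codRestrict W'
          (fun x => by simp [W', hlam])
      have hpr : ∀ x, lam x = 0 → (pr x : W) = x := fun x hx => by simp [pr, hx]
      let α : ℂ → ℂ := fun z => lam (g z v₀)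
      have hα0 : α z₀ = 1 := hlam
      have hα : AnalyticAt ℂ α z₀ :=
        (lam.analyticAt _).comp (AnalyticAt.clm_apply' hg analyticAt_const)
      let B : ℂ → V →L[ℂ] V := fun z => (α z)⁻¹ •
        (ContinuousLinearMap.toSpanSingleton ℂ v₀).comp (lam.comp (g z))
      have hB : AnalyticAt ℂ B z₀ := (hα.inv (by simp [hα0])).smul
        (AnalyticAt.clm_comp' analyticAt_const (AnalyticAt.clm_comp' analyticAt_const hg))
      have hBapp : ∀ z x, B z x = ((α z)⁻¹ * lam (g z x)) • v₀ := fun z x => by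
        simp [B, smul_smul]
      -- The column operation: C z subtracts the multiple of v₀ that makes lam ∘ g z vanish on its
      -- image, and C z₀ is the inclusion. The factor (z - z₀)^m stays inside N below, so that M z ∘
      -- C z equals N z near z₀.
      let C : ℂ → V' →L[ℂ] V := fun z => (ContinuousLinearMap.id ℂ V - B z).comp V'.subtypeL
      have hC : AnalyticAt ℂ C z₀ :=
        AnalyticAt.clm_comp' (analyticAt_const.sub hB) analyticAt_const
      have hC0 : ∀ x : V', C z₀ x = x := fun x => by
        have : lam (g z₀ x) = 0 := x.2
        simp [C, hBapp, this]
      let N : ℂ → V' →L[ℂ] W' := fun z => pr.comp (((z - z₀) ^ m • g z).comp (C z))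
      have hN : AnalyticAt ℂ N z₀ := by
        have hp : AnalyticAt ℂ (fun z : ℂ => (z - z₀) ^ m) z₀ := by fun_prop
        exact AnalyticAt.clm_comp' analyticAt_const (AnalyticAt.clm_comp' (hp.smul hg) hC)
      have hNM : ∀ᶠ z in 𝓝 z₀, ∀ x : V', M z (C z x) = (N z x : W) := by
        filter_upwards [hMg, hα.continuousAt.eventually_ne (show α z₀ ≠ 0 by simp [hα0])]
          with z hz hαz x
        have h0 : lam (g z (C z x)) = 0 := by
          have : lam (g z v₀) ≠ 0 := hαz
          simp only [C, ContinuousLinearMap.comp_apply, sub_apply, hBapp, map_sub, map_smul, α,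
            ContinuousLinearMap.id_apply, smul_eq_mul]
          field_simp
          simp
        simp only [N, smul_apply, ContinuousLinearMap.comp_apply, map_smul, Submodule.coe_smul, hz,
          hpr _ h0]
      obtain ⟨k, l, hkl, ⟨S⟩⟩ := ih V' W' N hV' hN
      refine ⟨k + 1, l, by omega, ⟨{
        v := Fin.cons (fun _ => v₀) (fun i z => C z (S.v i z))
        u := fun i z => C z (S.u i z)
        w := Fin.cons (fun z => g z v₀) (fun i z => (S.w i z : W))
        a := Fin.cons m S.a
        analytic_v := fun i => Fin.cases analyticAt_const
          (fun i => AnalyticAt.clm_apply' hC (S.analytic_v i)) i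
        analytic_u := fun i => AnalyticAt.clm_apply' hC (S.analytic_u i)
        analytic_w := fun i => Fin.cases (AnalyticAt.clm_apply' hg analyticAt_const)
          (fun i => (W'.subtypeL.analyticAt _).comp (S.analytic_w i)) i
        indep := ?_
        indep_w := ?_
        map_v := ?_
        map_u := ?_ }⟩⟩
      · have h1 : (fun i : Fin (k + 1) => (Fin.cons (fun _ => v₀) (fun i z => C z (S.v i z)) :
            Fin (k + 1) → ℂ → V) i z₀) = Fin.cons v₀ (fun i => (S.v i z₀ : V)) := by
          funext i
          refine Fin.cases rfl (fun i => ?_) i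
          simp [hC0]
        simp only [h1, hC0]
        refine linearIndependent_sumElim_cons (μ : V →ₗ[ℂ] ℂ) (by simp [μ, hlam])
          (fun i => (S.v i z₀).2) (fun i => (S.u i z₀).2) ?_
        have h2 := S.indep.map' V'.subtype V'.ker_subtype
        rwa [Sum.comp_elim] at h2
      · have h1 : (fun i : Fin (k + 1) => (Fin.cons (fun z => g z v₀) (fun i z => (S.w i z : W)) :
            Fin (k + 1) → ℂ → W) i z₀) = Fin.cons (g z₀ v₀) (fun i => (S.w i z₀ : W)) := by
          funext i
          refine Fin.cases rfl (fun i => ?_) i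
          simp
        rw [h1, linearIndependent_finCons]
        refine ⟨S.indep_w.map' W'.subtype W'.ker_subtype, fun hmem => ?_⟩
        have hle : Submodule.span ℂ (Set.range fun i => (S.w i z₀ : W)) ≤ W' := by
          rw [Submodule.span_le]
          rintro _ ⟨i, rfl⟩
          exact (S.w i z₀).2
        have : lam (g z₀ v₀) = 0 := hle hmem
        simp [hlam] at this
      · filter_upwards [hMg, hNM, S.map_v] with z h1 h2 h3 i
        refine Fin.cases ?_ (fun i => ?_) i
        · simp [h1]
        · simp [h2, h3]
      · filter_upwards [hNM, S.map_u] with z h2 h3 i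
        simp [h2, h3]


/-! ### Gram determinants -/

section Gram

variable {V : Type*} [AddCommGroup V] [Module ℂ V] (c : InnerProductSpace.Core ℂ V)

theorem core_inner_sum_left {ι : Type*} [Fintype ι] (f : ι → V) (x : V) :
    c.inner (∑ i, f i) x = ∑ i, c.inner (f i) x := by
  let : NormedAddCommGroup V := c.toNormedAddCommGroup
  let : InnerProductSpace ℂ V := InnerProductSpace.ofCore c.toCore
  exact sum_inner Finset.univ f x

theorem core_inner_sum_right {ι : Type*} [Fintype ι] (f : ι → V) (x : V) :
    c.inner x (∑ i, f i) = ∑ i, c.inner x (f i) := by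
  let : NormedAddCommGroup V := c.toNormedAddCommGroup
  let : InnerProductSpace ℂ V := InnerProductSpace.ofCore c.toCore
  exact inner_sum Finset.univ f x

theorem core_inner_smul_right (x y : V) (a : ℂ) : c.inner x (a • y) = a * c.inner x y := by
  let : NormedAddCommGroup V := c.toNormedAddCommGroup
  let : InnerProductSpace ℂ V := InnerProductSpace.ofCore c.toCore
  exact inner_smul_right x y a

variable {ι κ : Type*} [Fintype ι] [DecidableEq ι] [Fintype κ] [DecidableEq κ]

/-- The Gram determinant of a family of vectors. -/
noncomputable def gramDet (b : ι → V) : ℝ :=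
  (Matrix.det (Matrix.of fun i j => c.inner (b i) (b j))).re

theorem gramDet_pos {b : ι → V} (hb : LinearIndependent ℂ b) : 0 < gramDet c b := by
  let : NormedAddCommGroup V := c.toNormedAddCommGroup
  let : InnerProductSpace ℂ V := InnerProductSpace.ofCore c.toCore
  exact (Complex.pos_iff.1 (Matrix.posDef_gram_of_linearIndependent hb).det_pos).1

/-- The inner product is conjugate linear on the left, so the Gram matrix G becomes P̄ G Pᵀ. -/
theorem gramDet_change {b b' : ι → V} (P : Matrix ι ι ℂ) (h : ∀ i, b' i = ∑ j, P i j • b j) :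
    gramDet c b' = ‖P.det‖ ^ 2 * gramDet c b := by
  have hm : (Matrix.of fun i j => c.inner (b' i) (b' j)) =
      (P.map (starRingEnd ℂ)) * (Matrix.of fun i j => c.inner (b i) (b j)) * P.transpose := by
    ext i j
    simp only [Matrix.mul_apply, Matrix.of_apply, Matrix.map_apply, Matrix.transpose_apply, h,
      core_inner_sum_left, core_inner_sum_right, c.smul_left, core_inner_smul_right,
      Finset.sum_mul]
    refine Finset.sum_congr rfl fun _ _ => ?_
    rw [Finset.mul_sum]
    exact Finset.sum_congr rfl fun _ _ => by ring
  have hd : (P.map (starRingEnd ℂ)).det = (starRingEnd ℂ) P.det :=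
    ((starRingEnd ℂ).map_det P).symm
  rw [gramDet, hm, Matrix.det_mul, Matrix.det_mul, Matrix.det_transpose, hd, gramDet]
  have : ∀ d G : ℂ, ((starRingEnd ℂ) d * G * d).re = ‖d‖ ^ 2 * G.re := by
    intro d G
    rw [mul_right_comm, ← Complex.normSq_eq_conj_mul_self, Complex.re_ofReal_mul,
      Complex.normSq_eq_norm_sq]
  exact this _ _

theorem gramDet_smul {b b' : ι → V} (a : ι → ℂ) (h : ∀ i, b' i = a i • b i) :
    gramDet c b' = ‖∏ i, a i‖ ^ 2 * gramDet c b := by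
  rw [gramDet_change c (Matrix.diagonal a) (b := b), Matrix.det_diagonal]
  intro i
  simp [h, Matrix.diagonal_apply]

theorem gramDet_comp_equiv (b : ι → V) (e : κ ≃ ι) : gramDet c (b ∘ e) = gramDet c b := by
  have : (Matrix.of fun i j => c.inner ((b ∘ e) i) ((b ∘ e) j)) =
      (Matrix.of fun i j => c.inner (b i) (b j)).submatrix e e := rfl
  rw [gramDet, this, Matrix.det_submatrix_equiv_self, gramDet]

/-- The change of frame is block triangular with diagonal blocks A and D, because s' lies in the
span of s; as T kills s, the vectors T v' depend on T v through A alone. Numerator and denominator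
both acquire the factor |det A|² |det D|². -/
theorem gramDet_sum_div_eq {T : V →ₗ[ℂ] V} {v v' : ι → V} {s s' : κ → V}
    (hs : ∀ j, T (s j) = 0) (hv : LinearIndependent ℂ (Sum.elim v s))
    (hv' : LinearIndependent ℂ (Sum.elim v' s'))
    (hspan : ∀ x, x ∈ Submodule.span ℂ (Set.range (Sum.elim v s)))
    (hss : ∀ j, s' j ∈ Submodule.span ℂ (Set.range s)) :
    gramDet c (fun i => T (v' i)) * gramDet c s' / gramDet c (Sum.elim v' s') =
      gramDet c (fun i => T (v i)) * gramDet c s / gramDet c (Sum.elim v s) := by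
  have h1 : ∀ i, ∃ p : ι ⊕ κ → ℂ, ∑ j, p j • Sum.elim v s j = v' i := fun i =>
    (Submodule.mem_span_range_iff_exists_fun ℂ).1 (hspan _)
  choose p hp using h1
  have h2 : ∀ i, ∃ d : κ → ℂ, ∑ j, d j • s j = s' i := fun i =>
    (Submodule.mem_span_range_iff_exists_fun ℂ).1 (hss i)
  choose d hd using h2
  let A : Matrix ι ι ℂ := Matrix.of fun i j => p i (Sum.inl j)
  let B : Matrix ι κ ℂ := Matrix.of fun i j => p i (Sum.inr j)
  let D : Matrix κ κ ℂ := Matrix.of d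
  have e1 := gramDet_change c (b := s) (b' := s') D fun i => (hd i).symm
  have e2 := gramDet_change c (b := fun i => T (v i)) (b' := fun i => T (v' i)) A fun i => by
    rw [← hp i]
    simp [A, hs]
  have e3 := gramDet_change c (b := Sum.elim v s) (b' := Sum.elim v' s')
    (Matrix.fromBlocks A B 0 D) (by
      rintro (i | i)
      · simp [← hp i, A, B]
      · simp [← hd i, D])
  rw [Matrix.det_fromBlocks_zero₂₁, norm_mul, mul_pow] at e3
  have h3 := (gramDet_pos c hv).ne'
  have h4 := (gramDet_pos c hv').ne'
  rw [e3] at h4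
  rw [e1, e2, e3]
  have h5 : ‖A.det‖ ≠ 0 := fun h => h4 (by simp [h])
  have h6 : ‖D.det‖ ≠ 0 := fun h => h4 (by simp [h])
  field_simp

end Gram


/-! ### Integration on a compact Riemann surface -/

section Surface

variable {X : Type*} [TopologicalSpace X] [ChartedSpace ℂ X]

/-- The inverse of the chart at `c`. -/
noncomputable abbrev chartInv (c : X) : ℂ → X := (chartAt ℂ c).symm

theorem two_le_infty : (2 : WithTop ℕ∞) ≤ ∞ := by
  exact WithTop.coe_le_coe.2 le_top

theorem integrableOn_of_eq_zero_off_compact {G : ℂ → ℝ} {T K : Set ℂ} (hT : IsOpen T)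
    (hG : ContinuousOn G T) (hK : IsCompact K) (hKT : K ⊆ T) (h0 : ∀ z ∈ T \ K, G z = 0) :
    IntegrableOn G T :=
  ((hG.mono hKT).integrableOn_compact hK).of_forall_sdiff_eq_zero hT.measurableSet h0

theorem contDiffAt_comp_chartInv [IsManifold 𝓘(ℂ, ℂ) ω X] {f : X → ℝ} {c : X} {z : ℂ}
    (hz : z ∈ (chartAt ℂ c).target) (hf : ContMDiffAt 𝓘(ℝ, ℂ) 𝓘(ℝ, ℝ) ∞ f (chartInv c z)) :
    ContDiffAt ℝ ∞ (f ∘ chartInv c) z := by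
  have := isManifold_real X
  have h1 : ContMDiffAt 𝓘(ℝ, ℂ) 𝓘(ℝ, ℂ) ∞ (chartInv c) z :=
    (contMDiffOn_chart_symm (x := c)).contMDiffAt ((chartAt ℂ c).open_target.mem_nhds hz)
  exact (hf.comp z h1).contDiffAt

theorem analyticAt_transition [IsManifold 𝓘(ℂ, ℂ) ω X] (c d : X) {z : ℂ}
    (hz : z ∈ ((chartAt ℂ c).symm ≫ₕ chartAt ℂ d).source) :
    AnalyticAt ℂ ((chartAt ℂ c).symm ≫ₕ chartAt ℂ d) z := by
  have h := (contDiffGroupoid ω 𝓘(ℂ, ℂ)).compatible (M := X) (chart_mem_atlas ℂ c)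
    (chart_mem_atlas ℂ d)
  rw [contDiffGroupoid, mem_groupoid_of_pregroupoid] at h
  have h1 : ContDiffOn ℂ ω ((chartAt ℂ c).symm ≫ₕ chartAt ℂ d)
    ((chartAt ℂ c).symm ≫ₕ chartAt ℂ d).source := by simpa [contDiffPregroupoid] using h.1
  exact (h1.contDiffAt (((chartAt ℂ c).symm ≫ₕ chartAt ℂ d).open_source.mem_nhds hz)).analyticAt

theorem chart_image_subset_target {c : X} {K : Set X} (hK : K ⊆ (chartAt ℂ c).source) :
    chartAt ℂ c '' K ⊆ (chartAt ℂ c).target := by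
  rintro _ ⟨q, hq, rfl⟩
  exact (chartAt ℂ c).map_source (hK hq)

theorem chartInv_notMem_of_notMem_image {c : X} {K : Set X} {z : ℂ}
    (hz : z ∈ (chartAt ℂ c).target) (h : z ∉ chartAt ℂ c '' K) : chartInv c z ∉ K := fun hm =>
  h ⟨_, hm, (chartAt ℂ c).right_inv hz⟩

theorem laplacian_comp_chartInv_eq_zero {f : X → ℝ} {c : X} {z : ℂ}
    (hz : z ∈ (chartAt ℂ c).target) (h : chartInv c z ∉ tsupport f) :
    Δ (f ∘ chartInv c) z = 0 := by
  have hev : ∀ᶠ q in 𝓝 (chartInv c z), f q = 0 := by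
    filter_upwards [(isClosed_tsupport f).isOpen_compl.mem_nhds h] with q hq
    exact image_eq_zero_of_notMem_tsupport hq
  have hc : ContinuousAt (chartInv c) z := (chartAt ℂ c).continuousAt_symm hz
  have h1 : f ∘ chartInv c =ᶠ[𝓝 z] fun _ => 0 := hc.eventually hev
  rw [(InnerProductSpace.laplacian_congr_nhds h1).eq_of_nhds]
  simp

theorem laplacian_sum {ι : Type*} (s : Finset ι) {f : ι → ℂ → ℝ} {z : ℂ}
    (hf : ∀ i ∈ s, ContDiffAt ℝ 2 (f i) z) : Δ (∑ i ∈ s, f i) z = ∑ i ∈ s, Δ (f i) z := by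
  classical
  induction s using Finset.induction_on with
  | empty =>
    have : (0 : ℂ → ℝ) = fun _ => 0 := rfl
    simp [this]
  | insert a s ha ih =>
    rw [Finset.sum_insert ha, Finset.sum_insert ha,
      (hf a (Finset.mem_insert_self _ _)).laplacian_add, ih]
    · exact fun i hi => hf i (Finset.mem_insert_of_mem hi)
    · have : ∑ i ∈ s, f i = fun w => ∑ i ∈ s, f i w := by ext; simp
      rw [this]
      exact ContDiffAt.sum fun i hi => hf i (Finset.mem_insert_of_mem hi)

variable [IsManifold 𝓘(ℂ, ℂ) ω X]

theorem continuousOn_laplacian_comp_chartInv {f : X → ℝ} (c : X)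
    (hf : ContMDiff 𝓘(ℝ, ℂ) 𝓘(ℝ, ℝ) ∞ f) :
    ContinuousOn (Δ (f ∘ chartInv c)) (chartAt ℂ c).target := fun _ hz =>
  (continuousAt_laplacian ((contDiffAt_comp_chartInv hz (hf _)).of_le
    two_le_infty)).continuousWithinAt

/-- The support conditions confine both integrals to the overlap of the two charts, where the
holomorphic transition map preserves Δf ds∧dt. -/
theorem integral_mul_laplacian_change_chart {ψ f : X → ℝ} {c d : X}
    (hf : ContMDiff 𝓘(ℝ, ℂ) 𝓘(ℝ, ℝ) ∞ f) (hψc : tsupport ψ ⊆ (chartAt ℂ c).source)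
    (hfd : tsupport f ⊆ (chartAt ℂ d).source) :
    ∫ z in (chartAt ℂ c).target, ψ (chartInv c z) * Δ (f ∘ chartInv c) z =
      ∫ z in (chartAt ℂ d).target, ψ (chartInv d z) * Δ (f ∘ chartInv d) z := by
  set e : OpenPartialHomeomorph ℂ ℂ := (chartAt ℂ c).symm ≫ₕ chartAt ℂ d with he
  have hsrc : ∀ z, z ∈ e.source ↔ z ∈ (chartAt ℂ c).target ∧ chartInv c z ∈ (chartAt ℂ d).source :=
    fun z => by simp [he, chartInv]
  have htgt : ∀ z, z ∈ e.target ↔ z ∈ (chartAt ℂ d).target ∧ chartInv d z ∈ (chartAt ℂ c).source :=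
    fun z => by simp [he, chartInv]
  have h1 : ∫ z in e.source, ψ (chartInv c z) * Δ (f ∘ chartInv c) z =
      ∫ z in (chartAt ℂ c).target, ψ (chartInv c z) * Δ (f ∘ chartInv c) z := by
    refine (setIntegral_eq_of_subset_of_forall_sdiff_eq_zero
      (chartAt ℂ c).open_target.measurableSet (fun z hz => ((hsrc z).1 hz).1) fun z hz => ?_).symm
    rw [laplacian_comp_chartInv_eq_zero hz.1, mul_zero]
    exact fun hm => hz.2 ((hsrc z).2 ⟨hz.1, hfd hm⟩)
  have h2 : ∫ z in e.target, ψ (chartInv d z) * Δ (f ∘ chartInv d) z =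
      ∫ z in (chartAt ℂ d).target, ψ (chartInv d z) * Δ (f ∘ chartInv d) z := by
    refine (setIntegral_eq_of_subset_of_forall_sdiff_eq_zero
      (chartAt ℂ d).open_target.measurableSet (fun z hz => ((htgt z).1 hz).1) fun z hz => ?_).symm
    rw [image_eq_zero_of_notMem_tsupport (f := ψ), zero_mul]
    exact fun hm => hz.2 ((htgt z).2 ⟨hz.1, hψc hm⟩)
  rw [← h1, ← h2, integral_target_mul_laplacian e (fun z hz => analyticAt_transition c d hz) _ _
    fun w hw => (contDiffAt_comp_chartInv ((htgt w).1 hw).1 (hf _)).of_le two_le_infty]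
  refine setIntegral_congr_fun e.open_source.measurableSet fun z hz => ?_
  have hinv : ∀ w ∈ e.source, chartInv d (e w) = chartInv c w := fun w hw =>
    (chartAt ℂ d).left_inv ((hsrc w).1 hw).2
  have hev : (f ∘ chartInv d) ∘ e =ᶠ[𝓝 z] f ∘ chartInv c := by
    filter_upwards [e.open_source.mem_nhds hz] with w hw
    simp only [Function.comp_apply, hinv w hw]
  simp only [hinv z hz, (InnerProductSpace.laplacian_congr_nhds hev).eq_of_nhds]

variable [CompactSpace X]

/-- Extended by zero from the chart, f becomes a compactly supported C² function on the plane. -/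
theorem integral_laplacian_comp_chartInv {f : X → ℝ} {c : X}
    (hf : ContMDiff 𝓘(ℝ, ℂ) 𝓘(ℝ, ℝ) ∞ f) (hfc : tsupport f ⊆ (chartAt ℂ c).source) :
    ∫ z in (chartAt ℂ c).target, Δ (f ∘ chartInv c) z = 0 := by
  classical
  set K := chartAt ℂ c '' tsupport f with hK
  have hKc : IsCompact K := (isClosed_tsupport f).isCompact.image_of_continuousOn
    ((chartAt ℂ c).continuousOn.mono hfc)
  have hKT : K ⊆ (chartAt ℂ c).target := chart_image_subset_target hfc
  set g : ℂ → ℝ := (chartAt ℂ c).target.indicator (f ∘ chartInv c) with hg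
  have hg0 : ∀ z ∉ K, g z = 0 := by
    intro z hz
    by_cases hzT : z ∈ (chartAt ℂ c).target
    · rw [hg, Set.indicator_of_mem hzT]
      exact image_eq_zero_of_notMem_tsupport (f := f) (chartInv_notMem_of_notMem_image hzT hz)
    · exact Set.indicator_of_notMem hzT _
  have hgT : ∀ z ∈ (chartAt ℂ c).target, g =ᶠ[𝓝 z] f ∘ chartInv c := by
    intro z hz
    filter_upwards [(chartAt ℂ c).open_target.mem_nhds hz] with w hw
    exact Set.indicator_of_mem hw _
  have hgK : ∀ z ∉ K, g =ᶠ[𝓝 z] fun _ => 0 := by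
    intro z hz
    filter_upwards [hKc.isClosed.isOpen_compl.mem_nhds hz] with w hw
    exact hg0 w hw
  have hgs : ContDiff ℝ 2 g := by
    rw [contDiff_iff_contDiffAt]
    intro z
    by_cases hz : z ∈ K
    · exact ((contDiffAt_comp_chartInv (hKT hz) (hf _)).of_le two_le_infty).congr_of_eventuallyEq
        (hgT z (hKT hz))
    · exact contDiffAt_const.congr_of_eventuallyEq (hgK z hz)
  have hgc : HasCompactSupport g := HasCompactSupport.intro hKc hg0
  rw [← integral_laplacian_eq_zero hgs hgc, ← setIntegral_univ (f := Δ g)]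
  rw [setIntegral_congr_fun (chartAt ℂ c).open_target.measurableSet
    (fun z hz => (InnerProductSpace.laplacian_congr_nhds (hgT z hz)).eq_of_nhds.symm)]
  symm
  refine setIntegral_eq_of_subset_of_forall_sdiff_eq_zero MeasurableSet.univ (Set.subset_univ _)
    fun z hz => ?_
  rw [(InnerProductSpace.laplacian_congr_nhds (hgK z fun h => hz.2 (hKT h))).eq_of_nhds]
  simp

/-! ### The partition of unity and the integral over the surface. -/

variable [T2Space X]

theorem tsupport_partition (c : X) : tsupport (partition X c) ⊆ (chartAt ℂ c).source :=
  (exists_partition X).choose_spec c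

variable (X) in
/-- The finitely many charts that occur in the partition of unity. -/
noncomputable def partitionIndex : Finset X :=
  (partition X).locallyFinite.finite_nonempty_of_compact.toFinset

theorem partition_eq_zero {c : X} (hc : c ∉ partitionIndex X) (q : X) : partition X c q = 0 := by
  by_contra h
  exact hc (Set.Finite.mem_toFinset _ |>.2 ⟨q, h⟩)

theorem sum_partition (q : X) : ∑ c ∈ partitionIndex X, partition X c q = 1 := by
  rw [← (partition X).sum_eq_one (Set.mem_univ q)]
  refine (finsum_eq_sum_of_support_subset _ fun c hc => ?_).symm
  by_contra h
  exact hc (partition_eq_zero (fun h' => h (by simpa using h')) q)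

theorem surfaceIntegral_eq_sum (f : X → ℂ → ℝ) :
    surfaceIntegral f = ∑ c ∈ partitionIndex X,
      ∫ z in (chartAt ℂ c).target, partition X c (chartInv c z) * f c z := by
  refine finsum_eq_sum_of_support_subset _ fun c hc => ?_
  by_contra h
  refine hc ?_
  simp [partition_eq_zero (fun h' => h (by simpa using h'))]

theorem integrableOn_partition_mul {G : ℂ → ℝ} {c : X} (hG : ContinuousOn G (chartAt ℂ c).target) :
    IntegrableOn (fun z => partition X c (chartInv c z) * G z) (chartAt ℂ c).target := by
  refine integrableOn_of_eq_zero_off_compact (chartAt ℂ c).open_target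
    (((partition X c).contMDiff.continuous.comp_continuousOn
      (chartAt ℂ c).continuousOn_symm).mul hG)
    ((isClosed_tsupport (partition X c)).isCompact.image_of_continuousOn
      ((chartAt ℂ c).continuousOn.mono (tsupport_partition c)))
    (chart_image_subset_target (tsupport_partition c)) fun z hz => ?_
  rw [image_eq_zero_of_notMem_tsupport (chartInv_notMem_of_notMem_image hz.1 hz.2), zero_mul]

/-- The integral of the Laplacian of a smooth function vanishes. -/
theorem surfaceIntegral_laplacian {F : X → ℝ} (hF : ContMDiff 𝓘(ℝ, ℂ) 𝓘(ℝ, ℝ) ∞ F) :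
    surfaceIntegral (fun c => Δ (F ∘ chartInv c)) = 0 := by
  -- Two partitions are in play: F is cut into pieces supported in single charts d, on top of the
  -- cut by charts c made in the integral.
  set f : X → X → ℝ := fun d q => partition X d q * F q with hfdef
  have hf : ∀ d, ContMDiff 𝓘(ℝ, ℂ) 𝓘(ℝ, ℝ) ∞ (f d) := fun d => (partition X d).contMDiff.mul hF
  have hfs : ∀ d, tsupport (f d) ⊆ (chartAt ℂ d).source := fun d =>
    (tsupport_mul_subset_left).trans (tsupport_partition d)
  have hsum : ∀ c : X, F ∘ chartInv c = ∑ d ∈ partitionIndex X, f d ∘ chartInv c := by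
    intro c
    ext z
    simp [hfdef, ← Finset.sum_mul, sum_partition]
  have h1 : ∀ c : X, ∫ z in (chartAt ℂ c).target,
      partition X c (chartInv c z) * Δ (F ∘ chartInv c) z =
      ∑ d ∈ partitionIndex X, ∫ z in (chartAt ℂ c).target,
        partition X c (chartInv c z) * Δ (f d ∘ chartInv c) z := by
    intro c
    rw [← integral_finsetSum _ fun d _ =>
      integrableOn_partition_mul (continuousOn_laplacian_comp_chartInv c (hf d))]
    refine setIntegral_congr_fun (chartAt ℂ c).open_target.measurableSet fun z hz => ?_
    rw [hsum c, laplacian_sum _ fun d _ =>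
      (contDiffAt_comp_chartInv hz (hf d _)).of_le two_le_infty, Finset.mul_sum]
  rw [surfaceIntegral_eq_sum]
  simp only [h1]
  rw [Finset.sum_comm]
  refine Finset.sum_eq_zero fun d _ => ?_
  have h2 : ∀ c : X, ∫ z in (chartAt ℂ c).target,
      partition X c (chartInv c z) * Δ (f d ∘ chartInv c) z =
      ∫ z in (chartAt ℂ d).target, partition X c (chartInv d z) * Δ (f d ∘ chartInv d) z :=
    fun c => integral_mul_laplacian_change_chart (hf d) (tsupport_partition c) (hfs d)
  -- For a fixed piece every integral now takes place in the chart at d, where the weights indexed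
  -- by c sum to 1.
  simp only [h2]
  rw [← integral_finsetSum, ← integral_laplacian_comp_chartInv (hf d) (hfs d)]
  · refine setIntegral_congr_fun (chartAt ℂ d).open_target.measurableSet fun z hz => ?_
    simp only [← Finset.sum_mul, sum_partition, one_mul]
  · intro c _
    refine integrableOn_of_eq_zero_off_compact (chartAt ℂ d).open_target
      (((partition X c).contMDiff.continuous.comp_continuousOn
        (chartAt ℂ d).continuousOn_symm).mul (continuousOn_laplacian_comp_chartInv d (hf d)))
      ((isClosed_tsupport (f d)).isCompact.image_of_continuousOn
        ((chartAt ℂ d).continuousOn.mono (hfs d)))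
      (chart_image_subset_target (hfs d)) fun z hz => ?_
    rw [laplacian_comp_chartInv_eq_zero hz.1 (chartInv_notMem_of_notMem_image hz.1 hz.2), mul_zero]

end Surface


/-! ### Local coordinates for bundles and sections -/

section Coordinates

universe w

variable {X : Type*} [TopologicalSpace X] {r : ℕ} {E : X → Type w}
  [∀ p, TopologicalSpace (E p)]
  [TopologicalSpace (TotalSpace (Fin r → ℂ) E)] [FiberBundle (Fin r → ℂ) E]

variable (r) in
/-- The section `s` is continuous at `p`. -/
def ContinuousSectionAt (s : ∀ q, E q) (p : X) : Prop :=
  ContinuousAt (fun q => (⟨q, s q⟩ : TotalSpace (Fin r → ℂ) E)) p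

theorem IsHolomorphicSectionOn.continuousSectionAt [ChartedSpace ℂ X] {s : ∀ q, E q} {U : Set X}
    (hs : IsHolomorphicSectionOn r s U) {p : X} (hU : U ∈ 𝓝 p) : ContinuousSectionAt r s p :=
  (ContMDiffOn.contMDiffAt hs hU).continuousAt

variable [∀ p, AddCommGroup (E p)]

theorem IsHolomorphicMap.comp_section [ChartedSpace ℂ X] [∀ p, Module ℂ (E p)] {r' : ℕ} {E' : X → Type w}
    [∀ p, AddCommGroup (E' p)] [∀ p, Module ℂ (E' p)] [∀ p, TopologicalSpace (E' p)]
    [TopologicalSpace (TotalSpace (Fin r' → ℂ) E')] [FiberBundle (Fin r' → ℂ) E']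
    {T : FibreMap E E'} (hT : IsHolomorphicMap r r' T) {s : ∀ q, E q} {U : Set X}
    (hs : IsHolomorphicSectionOn r s U) : IsHolomorphicSectionOn r' (fun q => T q (s q)) U :=
  ContMDiff.comp_contMDiffOn hT hs

variable [∀ p, Module ℂ (E p)] [VectorBundle ℂ (Fin r → ℂ) E]

variable (r E) in
/-- The domain of the trivialization at `b`. -/
abbrev coordSet (b : X) : Set X := (trivializationAt (Fin r → ℂ) E b).baseSet

variable (r E) in
/-- The coordinates of a vector in the trivialization at `b`. -/
noncomputable def coordMap (b q : X) : E q →ₗ[ℂ] (Fin r → ℂ) :=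
  (trivializationAt (Fin r → ℂ) E b).linearMapAt ℂ q

variable (r E) in
/-- The vector with given coordinates in the trivialization at `b`. -/
noncomputable def coordSymm (b q : X) : (Fin r → ℂ) →ₗ[ℂ] E q :=
  (trivializationAt (Fin r → ℂ) E b).symmₗ ℂ q

theorem coordMap_apply {b q : X} (hq : q ∈ coordSet r E b) (x : E q) :
    coordMap r E b q x = (trivializationAt (Fin r → ℂ) E b ⟨q, x⟩).2 := by
  rw [coordMap, Trivialization.coe_linearMapAt_of_mem _ hq]

theorem coordMap_coordSymm {b q : X} (hq : q ∈ coordSet r E b) (y : Fin r → ℂ) :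
    coordMap r E b q (coordSymm r E b q y) = y :=
  Trivialization.linearMapAt_symmₗ _ hq y

theorem coordSymm_coordMap {b q : X} (hq : q ∈ coordSet r E b) (x : E q) :
    coordSymm r E b q (coordMap r E b q x) = x :=
  Trivialization.symmₗ_linearMapAt _ hq x

theorem linearIndependent_coordMap {ι : Type*} {b q : X} (hq : q ∈ coordSet r E b) {f : ι → E q}
    (h : LinearIndependent ℂ f) : LinearIndependent ℂ (fun i => coordMap r E b q (f i)) :=
  h.map' _ (LinearMap.ker_eq_bot_of_inverse (LinearMap.ext (coordSymm_coordMap hq)))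

theorem linearIndependent_coordSymm {ι : Type*} {b q : X} (hq : q ∈ coordSet r E b)
    {f : ι → Fin r → ℂ} (h : LinearIndependent ℂ f) :
    LinearIndependent ℂ (fun i => coordSymm r E b q (f i)) :=
  h.map' _ (LinearMap.ker_eq_bot_of_inverse (LinearMap.ext (coordMap_coordSymm hq)))

variable (r E) in
/-- The fibres of a vector bundle are identified with the model fibre. -/
noncomputable def fibreEquiv (q : X) : E q ≃ₗ[ℂ] (Fin r → ℂ) :=
  (trivializationAt (Fin r → ℂ) E q).linearEquivAt ℂ q (mem_baseSet_trivializationAt _ _ _)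

variable (r E) in
theorem finrank_fibre (q : X) : Module.finrank ℂ (E q) = r := by
  rw [(fibreEquiv r E q).finrank_eq, Module.finrank_fin_fun]

theorem continuousSectionAt_iff {s : ∀ q, E q} {b p : X} (hp : p ∈ coordSet r E b) :
    ContinuousSectionAt r s p ↔ ContinuousAt (fun q => coordMap r E b q (s q)) p := by
  have h1 : (fun q => coordMap r E b q (s q)) =ᶠ[𝓝 p]
      fun q => (trivializationAt (Fin r → ℂ) E b ⟨q, s q⟩).2 := by
    filter_upwards [(trivializationAt (Fin r → ℂ) E b).open_baseSet.mem_nhds hp] with q hq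
    exact coordMap_apply hq _
  rw [continuousAt_congr h1, ContinuousSectionAt, ContinuousAt,
    (trivializationAt (Fin r → ℂ) E b).tendsto_nhds_iff
      ((trivializationAt (Fin r → ℂ) E b).mem_source.2 hp)]
  exact and_iff_right continuousAt_id

variable [ChartedSpace ℂ X] [IsManifold 𝓘(ℂ, ℂ) ω X]

theorem analyticAt_comp_chartInv {F : Type*} [NormedAddCommGroup F] [NormedSpace ℂ F]
    [CompleteSpace F] {f : X → F} {b q : X}
    (hq : q ∈ (chartAt ℂ b).source) (hf : ContMDiffAt 𝓘(ℂ, ℂ) 𝓘(ℂ, F) ω f q) :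
    AnalyticAt ℂ (f ∘ chartInv b) (chartAt ℂ b q) := by
  have h1 : ContMDiffAt 𝓘(ℂ, ℂ) 𝓘(ℂ, ℂ) ω (chartInv b) (chartAt ℂ b q) :=
    (contMDiffOn_chart_symm (x := b)).contMDiffAt
      ((chartAt ℂ b).open_target.mem_nhds ((chartAt ℂ b).map_source hq))
  have h2 : ContMDiffAt 𝓘(ℂ, ℂ) 𝓘(ℂ, F) ω f (chartInv b (chartAt ℂ b q)) := by
    rwa [chartInv, (chartAt ℂ b).left_inv hq]
  exact (h2.comp _ h1).contDiffAt.analyticAt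

theorem contMDiffAt_comp_chart {F : Type*} [NormedAddCommGroup F] [NormedSpace ℂ F]
    [CompleteSpace F] {f : ℂ → F} {b q : X}
    (hq : q ∈ (chartAt ℂ b).source) (hf : AnalyticAt ℂ f (chartAt ℂ b q)) :
    ContMDiffAt 𝓘(ℂ, ℂ) 𝓘(ℂ, F) ω (f ∘ chartAt ℂ b) q := by
  have h1 : ContMDiffAt 𝓘(ℂ, ℂ) 𝓘(ℂ, ℂ) ω (chartAt ℂ b) q :=
    (contMDiffOn_chart (x := b)).contMDiffAt ((chartAt ℂ b).open_source.mem_nhds hq)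
  exact (hf.contDiffAt (n := ω)).contMDiffAt.comp q h1

variable [ContMDiffVectorBundle ω (Fin r → ℂ) E 𝓘(ℂ, ℂ)]

theorem IsHolomorphicSectionOn.analyticAt {s : ∀ q, E q} {U : Set X}
    (hs : IsHolomorphicSectionOn r s U) {b b' q : X} (hU : U ∈ 𝓝 q)
    (hq : q ∈ (chartAt ℂ b).source) (hq' : q ∈ coordSet r E b') :
    AnalyticAt ℂ (fun z => coordMap r E b' (chartInv b z) (s (chartInv b z)))
      (chartAt ℂ b q) := by
  have h1 := ((trivializationAt (Fin r → ℂ) E b').contMDiffAt_section_iff (n := ω)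
    (IB := 𝓘(ℂ, ℂ)) hq').1 (ContMDiffOn.contMDiffAt hs hU)
  have h2 : (fun q => (trivializationAt (Fin r → ℂ) E b' ⟨q, s q⟩).2) =ᶠ[𝓝 q]
      fun q => coordMap r E b' q (s q) := by
    filter_upwards [(trivializationAt (Fin r → ℂ) E b').open_baseSet.mem_nhds hq'] with x hx
    exact (coordMap_apply hx _).symm
  exact analyticAt_comp_chartInv hq (h1.congr_of_eventuallyEq h2.symm)

theorem isHolomorphicSectionOn_coordSymm {σ : ℂ → Fin r → ℂ} {b : X} {U : Set X} (hU : IsOpen U)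
    (hUb : U ⊆ (chartAt ℂ b).source) (hUb' : U ⊆ coordSet r E b)
    (hσ : ∀ q ∈ U, AnalyticAt ℂ σ (chartAt ℂ b q)) :
    IsHolomorphicSectionOn r (fun q => coordSymm r E b q (σ (chartAt ℂ b q))) U := by
  intro q hq
  refine ContMDiffAt.contMDiffWithinAt ?_
  rw [(trivializationAt (Fin r → ℂ) E b).contMDiffAt_section_iff (hUb' hq)]
  refine (contMDiffAt_comp_chart (hUb hq) (hσ q hq)).congr_of_eventuallyEq ?_
  filter_upwards [hU.mem_nhds hq] with x hx
  rw [← coordMap_apply (hUb' hx), coordMap_coordSymm (hUb' hx), Function.comp_apply]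

/-- The matrix of a bundle endomorphism in the local coordinates at `b`. -/
noncomputable def coordEnd (r : ℕ) {E : X → Type w}
    [∀ p, AddCommGroup (E p)] [∀ p, Module ℂ (E p)] [∀ p, TopologicalSpace (E p)]
    [TopologicalSpace (TotalSpace (Fin r → ℂ) E)] [FiberBundle (Fin r → ℂ) E]
    [VectorBundle ℂ (Fin r → ℂ) E] (g : FibreMap E E) (b q : X) :
    (Fin r → ℂ) →L[ℂ] (Fin r → ℂ) :=
  LinearMap.toContinuousLinearMap (coordMap r E b q ∘ₗ g q ∘ₗ coordSymm r E b q)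

theorem analyticAt_coordEnd {g : FibreMap E E} (hg : IsHolomorphicMap r r g) {b q : X}
    (hq : q ∈ (chartAt ℂ b).source) (hq' : q ∈ coordSet r E b) :
    AnalyticAt ℂ (fun z => coordEnd r g b (chartInv b z)) (chartAt ℂ b q) := by
  set U := (chartAt ℂ b).source ∩ coordSet r E b
  have hU : IsOpen U :=
    (chartAt ℂ b).open_source.inter (trivializationAt (Fin r → ℂ) E b).open_baseSet
  have h1 : ∀ y : Fin r → ℂ,
      AnalyticAt ℂ (fun z => coordEnd r g b (chartInv b z) y) (chartAt ℂ b q) := fun y =>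
    (hg.comp_section (isHolomorphicSectionOn_coordSymm (σ := fun _ => y) hU Set.inter_subset_left
      Set.inter_subset_right fun _ _ => analyticAt_const)).analyticAt
      (hU.mem_nhds ⟨hq, hq'⟩) hq hq'
  -- An operator on ℂʳ is a fixed linear expression in its values on the standard basis, so
  -- analyticity of those values suffices.
  have h2 : (fun z => coordEnd r g b (chartInv b z)) = fun z => ∑ j : Fin r,
      ContinuousLinearMap.smulRightL ℂ (Fin r → ℂ) (Fin r → ℂ) (ContinuousLinearMap.proj j)
        (coordEnd r g b (chartInv b z) (Pi.single j 1)) := by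
    funext z
    ext y i
    have hy : y = ∑ j, y j • (Pi.single j 1 : Fin r → ℂ) := by
      ext j
      simp [Finset.sum_apply, Pi.single_apply]
    conv_lhs => rw [hy]
    simp
  rw [h2]
  exact Finset.analyticAt_fun_sum _ fun j _ =>
    (ContinuousLinearMap.analyticAt _ _).comp (h1 _)

/-- Near `p`: a holomorphic frame `(v, u)` of `E` such that `u` frames the kernel of `g` and
`w` frames the saturation of its image. -/
structure AdaptedFrame (r : ℕ) {E : X → Type w}
    [∀ p, AddCommGroup (E p)] [∀ p, Module ℂ (E p)] [∀ p, TopologicalSpace (E p)]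
    [TopologicalSpace (TotalSpace (Fin r → ℂ) E)] [FiberBundle (Fin r → ℂ) E]
    (g : FibreMap E E) (p : X) (k l : ℕ) where
  U : Set X
  isOpen : IsOpen U
  mem : p ∈ U
  subset_source : U ⊆ (chartAt ℂ p).source
  v : Fin k → ∀ q, E q
  u : Fin l → ∀ q, E q
  w : Fin k → ∀ q, E q
  a : Fin k → ℕ
  holomorphic_v : ∀ i, IsHolomorphicSectionOn r (v i) U
  holomorphic_u : ∀ i, IsHolomorphicSectionOn r (u i) U
  holomorphic_w : ∀ i, IsHolomorphicSectionOn r (w i) U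
  indep : ∀ q ∈ U, LinearIndependent ℂ (Sum.elim (fun i => v i q) (fun i => u i q))
  indep_w : ∀ q ∈ U, LinearIndependent ℂ (fun i => w i q)
  map_v : ∀ q ∈ U, ∀ i, g q (v i q) = (chartAt ℂ p q - chartAt ℂ p p) ^ a i • w i q
  map_u : ∀ q ∈ U, ∀ i, g q (u i q) = 0

theorem eventually_linearIndependent {ι Y F : Type*} [Finite ι] [TopologicalSpace Y]
    [NormedAddCommGroup F] [NormedSpace ℂ F] {f : ι → Y → F} {y : Y}
    (hf : ∀ i, ContinuousAt (f i) y) (h : LinearIndependent ℂ (fun i => f i y)) :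
    ∀ᶠ x in 𝓝 y, LinearIndependent ℂ (fun i => f i x) :=
  (tendsto_pi_nhds.2 hf).eventually h.eventually

/-- This is the Smith form of the local matrix of g, carried back to the bundle. Analyticity and
independence, being open conditions, and the identities for g all hold on one neighbourhood. -/
theorem exists_adaptedFrame {g : FibreMap E E} (hg : IsHolomorphicMap r r g) (p : X) :
    ∃ k l, k + l = r ∧ Nonempty (AdaptedFrame r g p k l) := by
  have hp := mem_chart_source ℂ p
  have hp' : p ∈ coordSet r E p := mem_baseSet_trivializationAt (Fin r → ℂ) E p
  set z₀ := chartAt ℂ p p with hz₀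
  set M : ℂ → (Fin r → ℂ) →L[ℂ] (Fin r → ℂ) := fun z => coordEnd r g p (chartInv p z) with hM
  obtain ⟨k, l, hkl, ⟨S⟩⟩ := exists_smithForm z₀ r (Fin r → ℂ) (Fin r → ℂ) M (by simp)
    (analyticAt_coordEnd hg hp hp')
  refine ⟨k, l, hkl, ?_⟩
  have hev : ∀ᶠ z in 𝓝 z₀, (∀ i, AnalyticAt ℂ (S.v i) z) ∧ (∀ i, AnalyticAt ℂ (S.u i) z) ∧
      (∀ i, AnalyticAt ℂ (S.w i) z) ∧
      LinearIndependent ℂ (Sum.elim (fun i => S.v i z) (fun i => S.u i z)) ∧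
      LinearIndependent ℂ (fun i => S.w i z) ∧
      (∀ i, M z (S.v i z) = (z - z₀) ^ S.a i • S.w i z) ∧ (∀ i, M z (S.u i z) = 0) := by
    have e4 : ∀ᶠ z in 𝓝 z₀,
        LinearIndependent ℂ (Sum.elim (fun i => S.v i z) (fun i => S.u i z)) := by
      have h : ∀ z, (fun i => Sum.elim S.v S.u i z) =
          Sum.elim (fun i => S.v i z) (fun i => S.u i z) := fun z => by
        funext i; rcases i with i | i <;> rfl
      simp only [← h]
      refine eventually_linearIndependent ?_ (by rw [h]; exact S.indep)
      rintro (i | i)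
      · exact (S.analytic_v i).continuousAt
      · exact (S.analytic_u i).continuousAt
    filter_upwards [eventually_all.2 fun i => (S.analytic_v i).eventually_analyticAt,
      eventually_all.2 fun i => (S.analytic_u i).eventually_analyticAt,
      eventually_all.2 fun i => (S.analytic_w i).eventually_analyticAt, e4,
      eventually_linearIndependent (fun i => (S.analytic_w i).continuousAt) S.indep_w,
      S.map_v, S.map_u] with z h1 h2 h3 h4 h5 h6 h7 using ⟨h1, h2, h3, h4, h5, h6, h7⟩
  obtain ⟨O, hO, hOo, hzO⟩ := eventually_nhds_iff.1 hev
  set U := ((chartAt ℂ p).source ∩ chartAt ℂ p ⁻¹' O) ∩ coordSet r E p with hU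
  have hUo : IsOpen U := ((chartAt ℂ p).isOpen_inter_preimage hOo).inter
    (trivializationAt (Fin r → ℂ) E p).open_baseSet
  have hUs : U ⊆ (chartAt ℂ p).source := fun q hq => hq.1.1
  have hUc : U ⊆ coordSet r E p := fun q hq => hq.2
  have hUO : ∀ q ∈ U, chartAt ℂ p q ∈ O := fun q hq => hq.1.2
  have hMq : ∀ q ∈ U, ∀ y, g q (coordSymm r E p q y) =
      coordSymm r E p q (M (chartAt ℂ p q) y) := by
    intro q hq y
    have h : M (chartAt ℂ p q) = coordEnd r g p q :=
      congrArg (coordEnd r g p) ((chartAt ℂ p).left_inv (hUs hq))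
    rw [h]
    exact (coordSymm_coordMap (hUc hq) _).symm
  refine ⟨{
    U := U
    isOpen := hUo
    mem := ⟨⟨hp, hzO⟩, hp'⟩
    subset_source := hUs
    v := fun i q => coordSymm r E p q (S.v i (chartAt ℂ p q))
    u := fun i q => coordSymm r E p q (S.u i (chartAt ℂ p q))
    w := fun i q => coordSymm r E p q (S.w i (chartAt ℂ p q))
    a := S.a
    holomorphic_v := fun i => isHolomorphicSectionOn_coordSymm hUo hUs hUc fun q hq =>
      (hO _ (hUO q hq)).1 i
    holomorphic_u := fun i => isHolomorphicSectionOn_coordSymm hUo hUs hUc fun q hq =>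
      (hO _ (hUO q hq)).2.1 i
    holomorphic_w := fun i => isHolomorphicSectionOn_coordSymm hUo hUs hUc fun q hq =>
      (hO _ (hUO q hq)).2.2.1 i
    indep := fun q hq => ?_
    indep_w := fun q hq => linearIndependent_coordSymm (hUc hq) (hO _ (hUO q hq)).2.2.2.2.1
    map_v := fun q hq i => ?_
    map_u := fun q hq i => ?_ }⟩
  · have h := linearIndependent_coordSymm (hUc hq) (hO _ (hUO q hq)).2.2.2.1
    convert h using 1
    funext i
    rcases i with i | i <;> rfl
  · rw [hMq q hq, (hO _ (hUO q hq)).2.2.2.2.2.1 i, map_smul]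
  · rw [hMq q hq, (hO _ (hUO q hq)).2.2.2.2.2.2 i, map_zero]

end Coordinates


/-! ### Saturated kernels and images -/

/-- Without isolated points, conditions imposed away from p constrain the value of a continuous
section at p. -/
theorem nhdsWithin_ne_neBot {X : Type*} [TopologicalSpace X] [ChartedSpace ℂ X] (p : X) :
    (𝓝[≠] p).NeBot := by
  rw [neBot_iff, ne_eq, ← isOpen_singleton_iff_punctured_nhds]
  intro h
  have h1 := (chartAt ℂ p).isOpen_image_of_subset_source h
    (Set.singleton_subset_iff.2 (mem_chart_source ℂ p))
  rw [Set.image_singleton] at h1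
  exact not_isOpen_singleton _ h1

section Saturation

universe w

variable {X : Type*} [TopologicalSpace X]
  {r : ℕ} {E : X → Type w}
  [∀ p, AddCommGroup (E p)] [∀ p, Module ℂ (E p)] [∀ p, TopologicalSpace (E p)]
  [TopologicalSpace (TotalSpace (Fin r → ℂ) E)] [FiberBundle (Fin r → ℂ) E]

variable (r) in
/-- The saturation of a family of subspaces: the values of the continuous local sections
which lie in the family away from the given point. -/
def satFibre (K : ∀ p, Submodule ℂ (E p)) (p : X) : Submodule ℂ (E p) :=
  Submodule.span ℂ {x | ∃ s : ∀ q, E q, s p = x ∧ ContinuousSectionAt r s p ∧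
    ∀ᶠ q in 𝓝[≠] p, s q ∈ K q}

/-- T carries an admissible section to an admissible section. Only continuity of T is used, which is
why saturation is phrased with continuous sections: φ and y are smooth but need not be holomorphic.
-/
theorem satFibre_le_comap {r' : ℕ} {E' : X → Type w}
    [∀ p, AddCommGroup (E' p)] [∀ p, Module ℂ (E' p)] [∀ p, TopologicalSpace (E' p)]
    [TopologicalSpace (TotalSpace (Fin r' → ℂ) E')] [FiberBundle (Fin r' → ℂ) E']
    {K : ∀ p, Submodule ℂ (E p)} {K' : ∀ p, Submodule ℂ (E' p)} {T : FibreMap E E'} {W : Set X}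
    {p : X} (hp : W ∈ 𝓝 p)
    (hT : ContinuousOn (T.total r r') {e | e.1 ∈ W})
    (hTK : ∀ q, K q ≤ (K' q).comap (T q)) :
    satFibre r K p ≤ (satFibre r' K' p).comap (T p) := by
  rw [satFibre, Submodule.span_le]
  rintro _ ⟨s, rfl, hs, hK⟩
  refine Submodule.subset_span ⟨fun q => T q (s q), rfl, ?_, hK.mono fun q hq => hTK q hq⟩
  have h1 : {e : TotalSpace (Fin r → ℂ) E | e.1 ∈ W} ∈
      𝓝 (⟨p, s p⟩ : TotalSpace (Fin r → ℂ) E) :=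
    (FiberBundle.continuous_proj (Fin r → ℂ) E).continuousAt hp
  have h2 := hT.continuousAt h1
  exact ContinuousAt.comp (f := fun q => (⟨q, s q⟩ : TotalSpace (Fin r → ℂ) E)) h2 hs

variable [VectorBundle ℂ (Fin r → ℂ) E]

/-- If an admissible section s had s(q) outside the span, then s together with the frame would be
independent at q, hence at nearby points; but at nearby points other than p and q, s lies in the
span of the frame. -/
theorem satFibre_eq_span [T1Space X] {K : ∀ p, Submodule ℂ (E p)} {U : Set X} {k : ℕ}
    {t : Fin k → ∀ q, E q} {p q : X} [(𝓝[≠] q).NeBot]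
    (ht : ∀ i, ContinuousSectionAt r (t i) q) (hU : U ∈ 𝓝 q)
    (hind : LinearIndependent ℂ (fun i => t i q))
    (hK : ∀ q' ∈ U, q' ≠ p → K q' = Submodule.span ℂ (Set.range fun i => t i q')) :
    satFibre r K q = Submodule.span ℂ (Set.range fun i => t i q) := by
  have hev : ∀ᶠ q' in 𝓝[≠] q, K q' = Submodule.span ℂ (Set.range fun i => t i q') := by
    have h1 : ∀ᶠ q' in 𝓝[≠] q, q' ≠ p := by
      by_cases hqp : q = p
      · rw [← hqp]; exact eventually_mem_nhdsWithin
      · exact eventually_nhdsWithin_of_eventually_nhds (isOpen_ne.mem_nhds hqp)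
    filter_upwards [h1, eventually_nhdsWithin_of_eventually_nhds hU] with q' h1 h2 using hK q' h2 h1
  have hq : q ∈ coordSet r E q := mem_baseSet_trivializationAt (Fin r → ℂ) E q
  apply le_antisymm
  · rw [satFibre, Submodule.span_le]
    rintro _ ⟨s, rfl, hs, hsK⟩
    by_contra hmem
    have h1 : LinearIndependent ℂ (Fin.cons (s q) (fun i => t i q) : Fin (k + 1) → E q) :=
      linearIndependent_finCons.2 ⟨hind, hmem⟩
    let f : Fin (k + 1) → ∀ q, E q := Fin.cons s t
    have hf : ∀ q', (fun i => f i q') = Fin.cons (s q') (fun i => t i q') := fun q' => by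
      funext i
      refine Fin.cases rfl (fun i => rfl) i
    have hfc : ∀ i, ContinuousSectionAt r (f i) q := fun i => Fin.cases hs (fun i => ht i) i
    rw [← hf] at h1
    have h2 := eventually_linearIndependent
      (fun i => (continuousSectionAt_iff hq).1 (hfc i)) (linearIndependent_coordMap hq h1)
    obtain ⟨q', h3, h4, h5⟩ := ((eventually_nhdsWithin_of_eventually_nhds h2).and
      (hev.and hsK)).exists
    have h6 : LinearIndependent ℂ (fun i => f i q') := LinearIndependent.of_comp _ h3
    rw [hf, linearIndependent_finCons] at h6
    exact h6.2 (h4 ▸ h5)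
  · rw [Submodule.span_le]
    rintro _ ⟨i, rfl⟩
    refine Submodule.subset_span ⟨t i, rfl, ht i, ?_⟩
    filter_upwards [hev] with q' h
    rw [h]
    exact Submodule.subset_span ⟨i, rfl⟩

end Saturation

/-! ### Saturated kernel and image in an adapted frame. -/

section AdaptedFrame

universe w

variable {X : Type*} [TopologicalSpace X] [ChartedSpace ℂ X]
  {r : ℕ} {E : X → Type w}
  [∀ p, AddCommGroup (E p)] [∀ p, Module ℂ (E p)] [∀ p, TopologicalSpace (E p)]
  [TopologicalSpace (TotalSpace (Fin r → ℂ) E)] [FiberBundle (Fin r → ℂ) E]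
  {g : FibreMap E E} {p q : X} {k l : ℕ}

theorem AdaptedFrame.chart_sub_ne_zero (A : AdaptedFrame r g p k l) (hq : q ∈ A.U) (hqp : q ≠ p) :
    chartAt ℂ p q - chartAt ℂ p p ≠ 0 := fun h =>
  hqp ((chartAt ℂ p).injOn (A.subset_source hq) (mem_chart_source ℂ p) (sub_eq_zero.1 h))

theorem AdaptedFrame.indep_u (A : AdaptedFrame r g p k l) (hq : q ∈ A.U) :
    LinearIndependent ℂ (fun i => A.u i q) :=
  (A.indep q hq).comp Sum.inr Sum.inr_injective

variable [VectorBundle ℂ (Fin r → ℂ) E]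

theorem AdaptedFrame.mem_span (A : AdaptedFrame r g p k l) (hkl : k + l = r) (hq : q ∈ A.U)
    (x : E q) :
    x ∈ Submodule.span ℂ (Set.range (Sum.elim (fun i => A.v i q) (fun i => A.u i q))) := by
  have := LinearEquiv.finiteDimensional (fibreEquiv r E q).symm
  rw [(A.indep q hq).span_eq_top_of_card_eq_finrank']
  · trivial
  · simp [finrank_fibre r E q, hkl]

theorem AdaptedFrame.exists_coeff (A : AdaptedFrame r g p k l) (hkl : k + l = r) (hq : q ∈ A.U)
    (x : E q) :
    ∃ (c : Fin k → ℂ) (d : Fin l → ℂ), ∑ i, c i • A.v i q + ∑ j, d j • A.u j q = x ∧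
      g q x = ∑ i, (c i * (chartAt ℂ p q - chartAt ℂ p p) ^ A.a i) • A.w i q := by
  obtain ⟨c, hc⟩ := (Submodule.mem_span_range_iff_exists_fun ℂ).1 (A.mem_span hkl hq x)
  rw [Fintype.sum_sum_type] at hc
  refine ⟨fun i => c (Sum.inl i), fun j => c (Sum.inr j), hc, ?_⟩
  rw [← hc]
  simp [A.map_v q hq, A.map_u q hq, smul_smul]

theorem AdaptedFrame.ker_eq (A : AdaptedFrame r g p k l) (hkl : k + l = r) (hq : q ∈ A.U)
    (hqp : q ≠ p) : LinearMap.ker (g q) = Submodule.span ℂ (Set.range fun i => A.u i q) := by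
  apply le_antisymm
  · intro x hx
    obtain ⟨c, d, hcd, hg⟩ := A.exists_coeff hkl hq x
    rw [LinearMap.mem_ker.1 hx] at hg
    have h1 := Fintype.linearIndependent_iff.1 (A.indep_w q hq) _ hg.symm
    have h2 : ∀ i, c i = 0 := fun i =>
      (mul_eq_zero.1 (h1 i)).resolve_right (pow_ne_zero _ (A.chart_sub_ne_zero hq hqp))
    rw [← hcd]
    simp only [h2, zero_smul, Finset.sum_const_zero, zero_add]
    exact Submodule.sum_mem _ fun j _ => Submodule.smul_mem _ _ (Submodule.subset_span ⟨j, rfl⟩)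
  · rw [Submodule.span_le]
    rintro _ ⟨j, rfl⟩
    exact A.map_u q hq j

theorem AdaptedFrame.range_eq (A : AdaptedFrame r g p k l) (hkl : k + l = r) (hq : q ∈ A.U)
    (hqp : q ≠ p) : LinearMap.range (g q) = Submodule.span ℂ (Set.range fun i => A.w i q) := by
  apply le_antisymm
  · rintro _ ⟨x, rfl⟩
    obtain ⟨c, d, -, hg⟩ := A.exists_coeff hkl hq x
    rw [hg]
    exact Submodule.sum_mem _ fun j _ => Submodule.smul_mem _ _ (Submodule.subset_span ⟨j, rfl⟩)
  · rw [Submodule.span_le]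
    rintro _ ⟨i, rfl⟩
    refine ⟨((chartAt ℂ p q - chartAt ℂ p p) ^ A.a i)⁻¹ • A.v i q, ?_⟩
    rw [map_smul, A.map_v q hq, smul_smul,
      inv_mul_cancel₀ (pow_ne_zero _ (A.chart_sub_ne_zero hq hqp)), one_smul]

theorem AdaptedFrame.satFibre_ker [T1Space X] (A : AdaptedFrame r g p k l) (hkl : k + l = r)
    (hq : q ∈ A.U) : satFibre r (fun q => LinearMap.ker (g q)) q =
      Submodule.span ℂ (Set.range fun i => A.u i q) := by
  have := nhdsWithin_ne_neBot q
  have hU := A.isOpen.mem_nhds hq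
  exact satFibre_eq_span (fun i => (A.holomorphic_u i).continuousSectionAt hU) hU (A.indep_u hq)
    fun q' hq' hqp => A.ker_eq hkl hq' hqp

theorem AdaptedFrame.satFibre_range [T1Space X] (A : AdaptedFrame r g p k l) (hkl : k + l = r)
    (hq : q ∈ A.U) : satFibre r (fun q => LinearMap.range (g q)) q =
      Submodule.span ℂ (Set.range fun i => A.w i q) := by
  have := nhdsWithin_ne_neBot q
  have hU := A.isOpen.mem_nhds hq
  exact satFibre_eq_span (fun i => (A.holomorphic_w i).continuousSectionAt hU) hU (A.indep_w q hq)
    fun q' hq' hqp => A.range_eq hkl hq' hqp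

theorem AdaptedFrame.satFibre_ker_le [T1Space X] (A : AdaptedFrame r g p k l) (hkl : k + l = r)
    (hq : q ∈ A.U) : satFibre r (fun q => LinearMap.ker (g q)) q ≤ LinearMap.ker (g q) := by
  rw [A.satFibre_ker hkl hq, Submodule.span_le]
  rintro _ ⟨j, rfl⟩
  exact A.map_u q hq j

theorem AdaptedFrame.range_le_satFibre [T1Space X] (A : AdaptedFrame r g p k l) (hkl : k + l = r)
    (hq : q ∈ A.U) : LinearMap.range (g q) ≤ satFibre r (fun q => LinearMap.range (g q)) q := by
  rw [A.satFibre_range hkl hq]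
  rintro _ ⟨x, rfl⟩
  obtain ⟨c, d, -, hg⟩ := A.exists_coeff hkl hq x
  rw [hg]
  exact Submodule.sum_mem _ fun j _ => Submodule.smul_mem _ _ (Submodule.subset_span ⟨j, rfl⟩)

variable [IsManifold 𝓘(ℂ, ℂ) ω X] [ContMDiffVectorBundle ω (Fin r → ℂ) E 𝓘(ℂ, ℂ)]

/-- The saturated kernel and image of a holomorphic endomorphism are holomorphic subbundles. -/
theorem exists_kernel_image [T1Space X] [ConnectedSpace X] (hg : IsHolomorphicMap r r g) :
    ∃ S I : HolomorphicSubbundle r E, S.fibre = satFibre r (fun q => LinearMap.ker (g q)) ∧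
      I.fibre = satFibre r (fun q => LinearMap.range (g q)) ∧ I.rank + S.rank = r ∧
      ∀ p, Nonempty (AdaptedFrame r g p I.rank S.rank) := by
  -- The size l of the kernel frame is the dimension of the saturated kernel, so it is locally
  -- constant, hence constant on the connected surface; k = r - l follows.
  let L : X → ℕ := fun p => Module.finrank ℂ (satFibre r (fun q => LinearMap.ker (g q)) p)
  have hL : ∀ (p : X) (k l : ℕ) (hkl : k + l = r) (A : AdaptedFrame r g p k l), ∀ q ∈ A.U,
      L q = l := by
    intro p k l hkl A q hq
    change Module.finrank ℂ (satFibre r (fun q => LinearMap.ker (g q)) q) = l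
    rw [A.satFibre_ker hkl hq, finrank_span_eq_card (A.indep_u hq), Fintype.card_fin]
  have hloc : IsLocallyConstant L := by
    rw [IsLocallyConstant.iff_eventually_eq]
    intro p
    obtain ⟨k, l, hkl, ⟨A⟩⟩ := exists_adaptedFrame hg p
    filter_upwards [A.isOpen.mem_nhds A.mem] with q hq
    rw [hL p k l hkl A q hq, hL p k l hkl A p A.mem]
  obtain ⟨p₀⟩ := (inferInstance : Nonempty X)
  obtain ⟨k, l, hkl, ⟨A₀⟩⟩ := exists_adaptedFrame hg p₀
  have hA : ∀ p, Nonempty (AdaptedFrame r g p k l) := by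
    intro p
    obtain ⟨k', l', hkl', ⟨A⟩⟩ := exists_adaptedFrame hg p
    have h1 : l' = l := by
      rw [← hL p k' l' hkl' A p A.mem, ← hL p₀ k l hkl A₀ p₀ A₀.mem]
      exact hloc.apply_eq_of_preconnectedSpace p p₀
    obtain rfl := h1
    obtain rfl : k' = k := by omega
    exact ⟨A⟩
  refine ⟨⟨_, l, fun p => ?_⟩, ⟨_, k, fun p => ?_⟩, rfl, rfl, hkl, hA⟩
  · obtain ⟨A⟩ := hA p
    exact ⟨A.U, A.u, A.mem, A.isOpen, A.holomorphic_u, fun q hq => A.indep_u hq,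
      fun q hq => (A.satFibre_ker hkl hq).symm⟩
  · obtain ⟨A⟩ := hA p
    exact ⟨A.U, A.w, A.mem, A.isOpen, A.holomorphic_w, A.indep_w,
      fun q hq => (A.satFibre_range hkl hq).symm⟩

end AdaptedFrame


/-! ### Gram determinants of holomorphic frames and the Chern density -/

/-- A `HermitianMetric` is smooth only through its squared norm; polarization transfers smoothness
to inner products of sections. -/
theorem core_inner_polarization {V : Type*} [AddCommGroup V] [Module ℂ V]
    (c : InnerProductSpace.Core ℂ V) (x y : V) :
    c.inner x y = (((c.inner (x + (1 : ℂ) • y) (x + (1 : ℂ) • y)).re : ℂ)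
      - ((c.inner (x + (-1 : ℂ) • y) (x + (-1 : ℂ) • y)).re : ℂ)
      + (((c.inner (x + (-Complex.I) • y) (x + (-Complex.I) • y)).re : ℂ)
      - ((c.inner (x + Complex.I • y) (x + Complex.I • y)).re : ℂ)) * Complex.I) / 4 := by
  let : NormedAddCommGroup V := c.toNormedAddCommGroup
  let : InnerProductSpace ℂ V := InnerProductSpace.ofCore c.toCore
  have hn : ∀ v : V, ((c.inner v v).re : ℂ) = (‖v‖ : ℂ) ^ 2 := fun v => by
    have h := inner_self_eq_norm_sq (𝕜 := ℂ) v
    exact_mod_cast h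
  have h := inner_eq_sum_norm_sq_div_four (𝕜 := ℂ) x y
  simp only [hn, one_smul, neg_smul, ← sub_eq_add_neg]
  exact h

theorem contDiff_gramMatrix_det {ι : Type*} [Fintype ι] [DecidableEq ι] :
    ContDiff ℝ ∞ (fun A : ι → ι → ℂ => (Matrix.det (Matrix.of A)).re) := by
  refine Complex.reCLM.contDiff.comp ?_
  simp only [Matrix.det_apply, Matrix.of_apply]
  refine ContDiff.sum fun σ _ => ContDiff.const_smul _ ?_
  exact contDiff_prod fun i _ => (contDiff_apply ℝ ℂ i).comp (contDiff_apply ℝ (ι → ℂ) (σ i))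

section Density

universe w

variable {X : Type*} [TopologicalSpace X] [ChartedSpace ℂ X]
  {r : ℕ} {E : X → Type w}

theorem IsHolomorphicSectionOn.contMDiffAt_real [∀ p, TopologicalSpace (E p)]
    [TopologicalSpace (TotalSpace (Fin r → ℂ) E)] [FiberBundle (Fin r → ℂ) E]
    {s : ∀ q, E q} {U : Set X}
    (hs : IsHolomorphicSectionOn r s U) {p : X} (hU : U ∈ 𝓝 p) :
    ContMDiffAt 𝓘(ℝ, ℂ) (modelR r) ∞ (fun q => (⟨q, s q⟩ : TotalSpace (Fin r → ℂ) E)) p := by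
  have h := ContMDiffOn.contMDiffAt hs hU
  rw [contMDiffAt_iff] at h ⊢
  exact ⟨h.1, (ContDiffWithinAt.restrict_scalars ℝ h.2).of_le (by simp)⟩

variable [∀ p, AddCommGroup (E p)] [∀ p, Module ℂ (E p)] [∀ p, TopologicalSpace (E p)]
  [TopologicalSpace (TotalSpace (Fin r → ℂ) E)] [FiberBundle (Fin r → ℂ) E]

theorem contMDiffAt_normSq (H : HermitianMetric r E) {s : ∀ q, E q} {U : Set X}
    (hs : IsHolomorphicSectionOn r s U) {p : X} (hU : U ∈ 𝓝 p) :
    ContMDiffAt 𝓘(ℝ, ℂ) 𝓘(ℝ, ℝ) ∞ (fun q => ((H.core q).inner (s q) (s q)).re) p :=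
  ContMDiffAt.comp (f := fun q => (⟨q, s q⟩ : TotalSpace (Fin r → ℂ) E)) p
    (H.smooth (⟨p, s p⟩ : TotalSpace (Fin r → ℂ) E)) (hs.contMDiffAt_real hU)

variable [VectorBundle ℂ (Fin r → ℂ) E]

theorem IsHolomorphicSectionOn.add_smul {s t : ∀ q, E q} {U : Set X}
    (hs : IsHolomorphicSectionOn r s U) (ht : IsHolomorphicSectionOn r t U) (c : ℂ) :
    IsHolomorphicSectionOn r (fun q => s q + c • t q) U :=
  ContMDiffOn.add_section hs (ContMDiffOn.const_smul_section (a := c) ht)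

theorem contMDiffAt_inner (H : HermitianMetric r E) {s t : ∀ q, E q} {U : Set X}
    (hs : IsHolomorphicSectionOn r s U) (ht : IsHolomorphicSectionOn r t U) {p : X}
    (hU : U ∈ 𝓝 p) :
    ContMDiffAt 𝓘(ℝ, ℂ) 𝓘(ℝ, ℂ) ∞ (fun q => (H.core q).inner (s q) (t q)) p := by
  have hN : ∀ c : ℂ, ContMDiffAt 𝓘(ℝ, ℂ) 𝓘(ℝ, ℂ) ∞
      (fun q => (((H.core q).inner (s q + c • t q) (s q + c • t q)).re : ℂ)) p := fun c =>
    (Complex.ofRealCLM.contDiff.contMDiff.contMDiffAt).comp p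
      (contMDiffAt_normSq H (hs.add_smul ht c) hU)
  have hP : ContDiff ℝ ∞ (fun v : Fin 4 → ℂ => (v 0 - v 1 + (v 2 - v 3) * Complex.I) / 4) := by
    fun_prop
  have h := (hP.contMDiff.contMDiffAt).comp p (contMDiffAt_pi_space.2 (fun i =>
    hN ((![1, -1, -Complex.I, Complex.I] : Fin 4 → ℂ) i)))
  refine h.congr_of_eventuallyEq (Eventually.of_forall fun q => ?_)
  exact core_inner_polarization _ _ _

theorem contMDiffAt_gramDet (H : HermitianMetric r E) {ι : Type*} [Fintype ι] [DecidableEq ι]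
    {s : ι → ∀ q, E q} {U : Set X}
    (hs : ∀ i, IsHolomorphicSectionOn r (s i) U) {p : X} (hU : U ∈ 𝓝 p) :
    ContMDiffAt 𝓘(ℝ, ℂ) 𝓘(ℝ, ℝ) ∞ (fun q => gramDet (H.core q) (fun i => s i q)) p :=
  (contDiff_gramMatrix_det.contMDiff.contMDiffAt).comp p (contMDiffAt_pi_space.2 fun i =>
    contMDiffAt_pi_space.2 fun j => contMDiffAt_inner H (hs i) (hs j) hU)

variable [IsManifold 𝓘(ℂ, ℂ) ω X]

theorem contDiffAt_logGram (H : HermitianMetric r E) {ι : Type*} [Fintype ι] [DecidableEq ι]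
    {s : ι → ∀ q, E q} {U : Set X}
    (hs : ∀ i, IsHolomorphicSectionOn r (s i) U) {c : X} {z : ℂ} (hz : z ∈ (chartAt ℂ c).target)
    (hU : U ∈ 𝓝 (chartInv c z)) (hind : LinearIndependent ℂ (fun i => s i (chartInv c z))) :
    ContDiffAt ℝ ∞ (fun z' => Real.log (gramDet (H.core (chartInv c z'))
      (fun i => s i (chartInv c z')))) z :=
  (contDiffAt_comp_chartInv hz (contMDiffAt_gramDet H hs hU)).log (gramDet_pos _ hind).ne'

variable [ContMDiffVectorBundle ω (Fin r → ℂ) E 𝓘(ℂ, ℂ)]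

/-- Changing the holomorphic frame changes the logarithm of the Gram determinant by a harmonic
function. -/
theorem exists_harmonic_logGram (H : HermitianMetric r E) {k : ℕ} {S : ∀ p, Submodule ℂ (E p)}
    {s t : Fin k → ∀ q, E q} {U U' : Set X} (hs : IsHolomorphicFrameOn r S s U)
    (ht : IsHolomorphicFrameOn r S t U') {c : X} {z : ℂ} (hz : z ∈ (chartAt ℂ c).target)
    (hU : chartInv c z ∈ U) (hU' : chartInv c z ∈ U') :
    ∃ f : ℂ → ℝ, InnerProductSpace.HarmonicAt f z ∧
      ∀ᶠ z' in 𝓝 z, H.logGram t (chartInv c z') = H.logGram s (chartInv c z') + f z' := by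
  set q := chartInv c z with hqdef
  have hq : q ∈ (chartAt ℂ c).source := (chartAt ℂ c).map_target hz
  have hqz : chartAt ℂ c q = z := (chartAt ℂ c).right_inv hz
  have hq' : q ∈ coordSet r E q := mem_baseSet_trivializationAt (Fin r → ℂ) E q
  have hsa : ∀ i, AnalyticAt ℂ (fun z => coordMap r E q (chartInv c z) (s i (chartInv c z))) z :=
    fun i => hqz ▸ (hs.holomorphic i).analyticAt (hs.isOpen.mem_nhds hU) hq hq'
  have hta : ∀ i, AnalyticAt ℂ (fun z => coordMap r E q (chartInv c z) (t i (chartInv c z))) z :=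
    fun i => hqz ▸ (ht.holomorphic i).analyticAt (ht.isOpen.mem_nhds hU') hq hq'
  have hinj := linearIndependent_coordMap hq' (hs.linearIndependent q hU)
  -- A constant left inverse of the frame s at z turns k-tuples of sections into analytic k × k
  -- matrices A. The transition determinant is then det (A t) / det (A s) near z, so the correction
  -- is a difference of logarithms of moduli of nonvanishing holomorphic functions, hence harmonic.
  obtain ⟨L, hL⟩ := LinearMap.exists_leftInverse_of_injective
    (Fintype.linearCombination ℂ (fun i => coordMap r E q q (s i q)))
    (LinearMap.ker_eq_bot.2 hinj.fintypeLinearCombination_injective)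
  let A : (Fin k → ∀ q, E q) → ℂ → Matrix (Fin k) (Fin k) ℂ := fun s z' =>
    Matrix.of fun i j => L (coordMap r E q (chartInv c z') (s i (chartInv c z'))) j
  have hAs0 : (A s z).det = 1 := by
    have : A s z = 1 := by
      ext i j
      have h := congrFun (LinearMap.congr_fun hL (Pi.single i 1)) j
      simp only [LinearMap.comp_apply, Fintype.linearCombination_apply_single, one_smul,
        LinearMap.id_apply] at h
      simp only [A, Matrix.of_apply]
      rw [h, Matrix.one_apply, Pi.single_apply]
      simp [eq_comm]
    rw [this, Matrix.det_one]
  have hdet : ∀ s : Fin k → ∀ q, E q,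
      (∀ i, AnalyticAt ℂ (fun z => coordMap r E q (chartInv c z) (s i (chartInv c z))) z) →
      AnalyticAt ℂ (fun z' => (A s z').det) z := by
    intro s h
    simp only [Matrix.det_apply, Units.smul_def, zsmul_eq_mul]
    refine Finset.analyticAt_fun_sum _ fun σ _ => analyticAt_const.mul ?_
    refine Finset.analyticAt_fun_prod _ fun i _ => ?_
    let Lj : (Fin r → ℂ) →L[ℂ] ℂ :=
      LinearMap.toContinuousLinearMap ((LinearMap.proj i : (Fin k → ℂ) →ₗ[ℂ] ℂ) ∘ₗ L)
    exact (Lj.analyticAt _).comp (h (σ i))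
  have hcont : ContinuousAt (chartInv c) z := (chartAt ℂ c).continuousAt_symm hz
  have key : ∀ z', chartInv c z' ∈ U → chartInv c z' ∈ U' → ∃ d : ℂ, d ≠ 0 ∧
      (A t z').det = d * (A s z').det ∧
      H.logGram t (chartInv c z') = H.logGram s (chartInv c z') + 2 * Real.log ‖d‖ := by
    intro z' h1 h2
    have h3 : ∀ i, ∃ p : Fin k → ℂ, ∑ j, p j • s j (chartInv c z') = t i (chartInv c z') := by
      intro i
      refine (Submodule.mem_span_range_iff_exists_fun ℂ).1 ?_
      rw [hs.span_eq _ h1, ← ht.span_eq _ h2]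
      exact Submodule.subset_span ⟨i, rfl⟩
    choose P hP using h3
    have e1 : A t z' = Matrix.of P * A s z' := by
      ext i j
      simp [A, Matrix.mul_apply, ← hP]
    have e2 := gramDet_change (H.core (chartInv c z')) (b := fun i => s i (chartInv c z'))
      (b' := fun i => t i (chartInv c z')) (Matrix.of P) fun i => (hP i).symm
    have p1 := gramDet_pos (H.core (chartInv c z')) (hs.linearIndependent _ h1)
    have p2 := gramDet_pos (H.core (chartInv c z')) (ht.linearIndependent _ h2)
    have hd : (Matrix.of P).det ≠ 0 := fun h => by simp [e2, h] at p2
    refine ⟨(Matrix.of P).det, hd, by rw [e1, Matrix.det_mul], ?_⟩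
    change Real.log (gramDet _ _) = Real.log (gramDet _ _) + _
    rw [e2, Real.log_mul (by simpa using hd) p1.ne', Real.log_pow]
    push_cast
    ring
  have hAt0 : (A t z).det ≠ 0 := by
    obtain ⟨d, hd, h, -⟩ := key z hU hU'
    rw [h, hAs0, mul_one]
    exact hd
  refine ⟨fun z' => 2 * (Real.log ‖(A t z').det‖ - Real.log ‖(A s z').det‖), ?_, ?_⟩
  · exact (((hdet t hta).harmonicAt_log_norm hAt0).sub
      ((hdet s hsa).harmonicAt_log_norm (by simp [hAs0]))).const_smul (c := (2 : ℝ))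
  · filter_upwards [hcont.eventually (hs.isOpen.mem_nhds hU),
      hcont.eventually (ht.isOpen.mem_nhds hU'),
      (hdet s hsa).continuousAt.eventually_ne (show (A s z).det ≠ 0 by simp [hAs0])]
      with z' h1 h2 h3
    obtain ⟨d, hd, h4, h5⟩ := key z' h1 h2
    rw [h5, h4, norm_mul, Real.log_mul (by simpa using hd) (by simpa using h3)]
    ring

/-- The Chern density can be computed in any holomorphic frame. -/
theorem chernDensity_eq (H : HermitianMetric r E) (S : HolomorphicSubbundle r E)
    {t : Fin S.rank → ∀ q, E q} {U : Set X} (ht : IsHolomorphicFrameOn r S.fibre t U) {c : X}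
    {z : ℂ} (hz : z ∈ (chartAt ℂ c).target) (hU : chartInv c z ∈ U) :
    H.chernDensity S c z =
      -(1 / (4 * Real.pi)) * Δ (fun z' => H.logGram t (chartInv c z')) z := by
  have hspec := (S.exists_frame (chartInv c z)).choose_spec.choose_spec
  obtain ⟨f, hf, he⟩ := exists_harmonic_logGram H ht hspec.2 hz hU hspec.1
  have h1 : ContDiffAt ℝ 2 (fun z' => H.logGram t (chartInv c z')) z :=
    (contDiffAt_logGram H ht.holomorphic hz (ht.isOpen.mem_nhds hU)
      (ht.linearIndependent _ hU)).of_le two_le_infty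
  rw [HermitianMetric.chernDensity, ← laplacian_add_harmonic h1 hf]
  congr 1
  exact (InnerProductSpace.laplacian_congr_nhds he).eq_of_nhds

/-- The density is defined with a frame that varies with the point, but near a given point a single
frame computes it. -/
theorem continuousOn_chernDensity (H : HermitianMetric r E) (S : HolomorphicSubbundle r E) (c : X) :
    ContinuousOn (H.chernDensity S c) (chartAt ℂ c).target := by
  intro z hz
  obtain ⟨U, t, hU, ht⟩ := S.exists_frame (chartInv c z)
  have h1 : ContDiffAt ℝ 2 (fun z' => H.logGram t (chartInv c z')) z :=
    (contDiffAt_logGram H ht.holomorphic hz (ht.isOpen.mem_nhds hU)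
      (ht.linearIndependent _ hU)).of_le two_le_infty
  have hcont : ContinuousAt (chartInv c) z := (chartAt ℂ c).continuousAt_symm hz
  refine ContinuousAt.continuousWithinAt ?_
  refine ((continuousAt_laplacian h1).const_mul (-(1 / (4 * Real.pi)))).congr ?_
  filter_upwards [hcont.eventually (ht.isOpen.mem_nhds hU),
    (chartAt ℂ c).open_target.mem_nhds hz] with z' h2 h3
  exact (chernDensity_eq H S ht h3 h2).symm

end Density


/-! ### The degree of the kernel and the image of an endomorphism -/

theorem finite_of_forall_nhds_inter_subset {X : Type*} [TopologicalSpace X] [CompactSpace X]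
    {Z : Set X} (h : ∀ p, ∃ U ∈ 𝓝 p, U ∩ Z ⊆ {p}) :
    Z.Finite := by
  choose U hU hUZ using h
  obtain ⟨t, -, ht⟩ := isCompact_univ.elim_nhds_subcover U fun p _ => hU p
  refine t.finite_toSet.subset fun q hq => ?_
  obtain ⟨p, hp, hqp⟩ := Set.mem_iUnion₂.1 (ht (Set.mem_univ q))
  have := hUZ p ⟨hqp, hq⟩
  rw [Set.mem_singleton_iff] at this
  exact this ▸ hp

theorem laplacian_add_sub {a b d : ℂ → ℝ} {z : ℂ} (ha : ContDiffAt ℝ 2 a z)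
    (hb : ContDiffAt ℝ 2 b z) (hd : ContDiffAt ℝ 2 d z) :
    Δ (a + b - d) z = Δ a z + Δ b z - Δ d z := by
  have hab : ContDiffAt ℝ 2 (a + b) z := ContDiffAt.add ha hb
  rw [hab.laplacian_sub hd, ha.laplacian_add hb]

section DegreeInequality

universe w

variable {X : Type*} [TopologicalSpace X] [ChartedSpace ℂ X]
  {r : ℕ} {E : X → Type w}
  [∀ p, AddCommGroup (E p)] [∀ p, Module ℂ (E p)] [∀ p, TopologicalSpace (E p)]
  [TopologicalSpace (TotalSpace (Fin r → ℂ) E)] [FiberBundle (Fin r → ℂ) E]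
  {g : FibreMap E E} {p q : X} {k l : ℕ}

/-- The squared norm of the map `det (E / ker g) → det (im g)` induced by `g`, computed in an
adapted frame. -/
noncomputable def AdaptedFrame.ratio (A : AdaptedFrame r g p k l) (H : HermitianMetric r E)
    (q : X) : ℝ :=
  gramDet (H.core q) (fun i => g q (A.v i q)) * gramDet (H.core q) (fun i => A.u i q) /
    gramDet (H.core q) (Sum.elim (fun i => A.v i q) (fun i => A.u i q))

theorem AdaptedFrame.ratio_eq (A : AdaptedFrame r g p k l) (H : HermitianMetric r E)
    (hq : q ∈ A.U) :
    A.ratio H q = ‖∏ i, (chartAt ℂ p q - chartAt ℂ p p) ^ A.a i‖ ^ 2 *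
      (gramDet (H.core q) (fun i => A.w i q) * gramDet (H.core q) (fun i => A.u i q) /
        gramDet (H.core q) (Sum.elim (fun i => A.v i q) (fun i => A.u i q))) := by
  rw [ratio, gramDet_smul (H.core q) (b := fun i => A.w i q)
    (fun i => (chartAt ℂ p q - chartAt ℂ p p) ^ A.a i) (A.map_v q hq)]
  ring

theorem AdaptedFrame.quotient_pos (A : AdaptedFrame r g p k l) (H : HermitianMetric r E)
    (hq : q ∈ A.U) :
    0 < gramDet (H.core q) (fun i => A.w i q) * gramDet (H.core q) (fun i => A.u i q) /
        gramDet (H.core q) (Sum.elim (fun i => A.v i q) (fun i => A.u i q)) :=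
  div_pos (mul_pos (gramDet_pos _ (A.indep_w q hq)) (gramDet_pos _ (A.indep_u hq)))
    (gramDet_pos _ (A.indep q hq))

theorem AdaptedFrame.ratio_nonneg (A : AdaptedFrame r g p k l) (H : HermitianMetric r E)
    (hq : q ∈ A.U) : 0 ≤ A.ratio H q := by
  rw [A.ratio_eq H hq]
  exact mul_nonneg (sq_nonneg _) (A.quotient_pos H hq).le

theorem AdaptedFrame.ratio_pos (A : AdaptedFrame r g p k l) (H : HermitianMetric r E)
    (hq : q ∈ A.U) (hqp : q ≠ p) : 0 < A.ratio H q := by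
  rw [A.ratio_eq H hq]
  refine mul_pos (pow_pos (norm_pos_iff.2 ?_) 2) (A.quotient_pos H hq)
  exact Finset.prod_ne_zero_iff.2 fun i _ => pow_ne_zero _ (A.chart_sub_ne_zero hq hqp)

/-- If the ratio does not vanish at the centre, then `g` maps `v` to `w`. -/
theorem AdaptedFrame.log_ratio (A : AdaptedFrame r g p k l) (H : HermitianMetric r E)
    (hp : 0 < A.ratio H p) (hq : q ∈ A.U) :
    Real.log (A.ratio H q) = Real.log (gramDet (H.core q) (fun i => A.w i q))
      + Real.log (gramDet (H.core q) (fun i => A.u i q))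
      - Real.log (gramDet (H.core q) (Sum.elim (fun i => A.v i q) (fun i => A.u i q))) := by
  -- At the centre the chart difference is 0, so a single positive exponent would make the ratio
  -- vanish there.
  have ha : ∀ i, A.a i = 0 := by
    intro i
    by_contra hi
    rw [A.ratio_eq H A.mem, Finset.prod_eq_zero (Finset.mem_univ i) (by simp [hi])] at hp
    simp at hp
  have h1 := (gramDet_pos (H.core q) (A.indep_w q hq)).ne'
  have h2 := (gramDet_pos (H.core q) (A.indep_u hq)).ne'
  have h3 := (gramDet_pos (H.core q) (A.indep q hq)).ne'
  rw [A.ratio_eq H hq]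
  simp only [ha, pow_zero, Finset.prod_const_one, norm_one, one_pow, one_mul]
  rw [Real.log_div (mul_ne_zero h1 h2) h3, Real.log_mul h1 h2]

theorem AdaptedFrame.isHolomorphicSectionOn_sum (A : AdaptedFrame r g p k l) (i : Fin k ⊕ Fin l) :
    IsHolomorphicSectionOn r (fun q => Sum.elim (fun i => A.v i q) (fun i => A.u i q) i) A.U := by
  rcases i with i | i
  · exact A.holomorphic_v i
  · exact A.holomorphic_u i

variable [VectorBundle ℂ (Fin r → ℂ) E]

/-- Both kernel frames span the saturated kernel at q, so the two adapted frames differ by a block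
triangular matrix. This makes the ratio a global function on X. -/
theorem AdaptedFrame.ratio_unique [T1Space X] {p' : X} (A : AdaptedFrame r g p k l)
    (A' : AdaptedFrame r g p' k l) (hkl : k + l = r) (H : HermitianMetric r E) (hq : q ∈ A.U)
    (hq' : q ∈ A'.U) : A'.ratio H q = A.ratio H q := by
  refine gramDet_sum_div_eq (H.core q) (A.map_u q hq) (A.indep q hq) (A'.indep q hq')
    (A.mem_span hkl hq) fun j => ?_
  rw [← A.satFibre_ker hkl hq, A'.satFibre_ker hkl hq']
  exact Submodule.subset_span ⟨j, rfl⟩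

theorem AdaptedFrame.contMDiffAt_ratio (A : AdaptedFrame r g p k l) (H : HermitianMetric r E)
    (hg : IsHolomorphicMap r r g) (hq : q ∈ A.U) :
    ContMDiffAt 𝓘(ℝ, ℂ) 𝓘(ℝ, ℝ) ∞ (A.ratio H) q := by
  have hU := A.isOpen.mem_nhds hq
  exact ((contMDiffAt_gramDet H (fun i => hg.comp_section (A.holomorphic_v i)) hU).mul
    (contMDiffAt_gramDet H A.holomorphic_u hU)).div₀
    (contMDiffAt_gramDet H A.isHolomorphicSectionOn_sum hU) (gramDet_pos _ (A.indep q hq)).ne'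

theorem AdaptedFrame.isHolomorphicFrameOn_whole (A : AdaptedFrame r g p k l)
    (e : Fin r ≃ Fin k ⊕ Fin l) (hkl : k + l = r) :
    IsHolomorphicFrameOn r (fun _ => (⊤ : Submodule ℂ _))
      (fun i q => Sum.elim (fun i => A.v i q) (fun i => A.u i q) (e i)) A.U where
  isOpen := A.isOpen
  holomorphic i := A.isHolomorphicSectionOn_sum (e i)
  linearIndependent q hq := (A.indep q hq).comp e e.injective
  span_eq q hq := by
    have h : (Set.range fun i => Sum.elim (fun i => A.v i q) (fun i => A.u i q) (e i)) =
        Set.range (Sum.elim (fun i => A.v i q) (fun i => A.u i q)) := e.surjective.range_comp _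
    rw [h]
    exact top_le_iff.1 fun x _ => A.mem_span hkl hq x

variable [IsManifold 𝓘(ℂ, ℂ) ω X] [ContMDiffVectorBundle ω (Fin r → ℂ) E 𝓘(ℂ, ℂ)]

/-- Away from the zeros of the ratio, its logarithm is a potential for the difference of the Chern
densities. -/
theorem AdaptedFrame.chernDensity_add_sub (H : HermitianMetric r E)
    {S I : HolomorphicSubbundle r E} (hkl : I.rank + S.rank = r) {c : X} {z : ℂ}
    (hz : z ∈ (chartAt ℂ c).target) (A : AdaptedFrame r g (chartInv c z) I.rank S.rank)
    (hI : IsHolomorphicFrameOn r I.fibre A.w A.U) (hS : IsHolomorphicFrameOn r S.fibre A.u A.U)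
    (hpos : 0 < A.ratio H (chartInv c z)) :
    H.chernDensity S c z + H.chernDensity I c z -
        H.chernDensity (HolomorphicSubbundle.whole r E) c z =
      -(1 / (4 * Real.pi)) * Δ (fun z' => Real.log (A.ratio H (chartInv c z'))) z := by
  -- A frame of the whole bundle must be indexed by `Fin r`; reindexing leaves the Gram determinant
  -- unchanged.
  let e : Fin r ≃ Fin I.rank ⊕ Fin S.rank := (finCongr hkl.symm).trans finSumFinEquiv.symm
  have hU := A.isOpen.mem_nhds A.mem
  have hW := A.isHolomorphicFrameOn_whole e hkl
  have eW : H.chernDensity (HolomorphicSubbundle.whole r E) c z = -(1 / (4 * Real.pi)) *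
      Δ (fun z' => H.logGram (fun i q =>
        Sum.elim (fun i => A.v i q) (fun i => A.u i q) (e i)) (chartInv c z')) z :=
    chernDensity_eq H (HolomorphicSubbundle.whole r E) hW hz A.mem
  rw [chernDensity_eq H S hS hz A.mem, chernDensity_eq H I hI hz A.mem, eW]
  have cS : ContDiffAt ℝ 2 (fun z' => H.logGram A.u (chartInv c z')) z :=
    (contDiffAt_logGram H A.holomorphic_u hz hU (A.indep_u A.mem)).of_le two_le_infty
  have cI : ContDiffAt ℝ 2 (fun z' => H.logGram A.w (chartInv c z')) z :=
    (contDiffAt_logGram H A.holomorphic_w hz hU (A.indep_w _ A.mem)).of_le two_le_infty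
  have cW : ContDiffAt ℝ 2 (fun z' => H.logGram (fun i q =>
      Sum.elim (fun i => A.v i q) (fun i => A.u i q) (e i)) (chartInv c z')) z :=
    (contDiffAt_logGram H hW.holomorphic hz hU (hW.linearIndependent _ A.mem)).of_le two_le_infty
  have hev : (fun z' => Real.log (A.ratio H (chartInv c z'))) =ᶠ[𝓝 z]
      ((fun z' => H.logGram A.w (chartInv c z')) + fun z' => H.logGram A.u (chartInv c z')) -
        fun z' => H.logGram (fun i q =>
          Sum.elim (fun i => A.v i q) (fun i => A.u i q) (e i)) (chartInv c z') := by
    filter_upwards [((chartAt ℂ c).continuousAt_symm hz).eventually hU] with z' hz'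
    have h := gramDet_comp_equiv (H.core (chartInv c z'))
      (Sum.elim (fun i => A.v i (chartInv c z')) (fun i => A.u i (chartInv c z'))) e
    rw [A.log_ratio H hpos hz', ← h]
    rfl
  rw [(InnerProductSpace.laplacian_congr_nhds hev).eq_of_nhds,
    laplacian_add_sub cI cS cW]
  ring

variable [CompactSpace X] [T2Space X]

/-- The degree of a bundle is at most the sum of the degrees of the saturated kernel and image of an
endomorphism. -/
theorem degree_whole_le [ConnectedSpace X] (hg : IsHolomorphicMap r r g)
    {S I : HolomorphicSubbundle r E} (hS : S.fibre = satFibre r (fun q => LinearMap.ker (g q)))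
    (hI : I.fibre = satFibre r (fun q => LinearMap.range (g q))) (hkl : I.rank + S.rank = r)
    (hA : ∀ p, Nonempty (AdaptedFrame r g p I.rank S.rank)) :
    (HolomorphicSubbundle.whole r E).degree ≤ S.degree + I.degree := by
  let A : ∀ p, AdaptedFrame r g p I.rank S.rank := fun p => (hA p).some
  -- All three degrees are computed with this one metric, so their densities can be compared
  -- pointwise.
  set H := (nonempty_hermitianMetric r E).some with hH
  -- Each point uses its own frame; by uniqueness of the ratio, u agrees near p with the smooth
  -- ratio of the frame centred at p.
  let u : X → ℝ := fun p => (A p).ratio H p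
  have hu : ∀ p, ∀ q ∈ (A p).U, u q = (A p).ratio H q := fun p q hq =>
    (A p).ratio_unique (A q) hkl H hq (A q).mem
  have hus : ContMDiff 𝓘(ℝ, ℂ) 𝓘(ℝ, ℝ) ∞ u := fun p => by
    refine ((A p).contMDiffAt_ratio H hg (A p).mem).congr_of_eventuallyEq ?_
    filter_upwards [(A p).isOpen.mem_nhds (A p).mem] with q hq using hu p q hq
  have hu0 : ∀ p, 0 ≤ u p := fun p => (A p).ratio_nonneg H (A p).mem
  have hZ : {p | u p = 0}.Finite := by
    refine finite_of_forall_nhds_inter_subset fun p =>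
      ⟨(A p).U, (A p).isOpen.mem_nhds (A p).mem, ?_⟩
    rintro q ⟨hq, hq0⟩
    by_contra hqp
    have h1 := (A p).ratio_pos H hq hqp
    rw [← hu p q hq] at h1
    exact h1.ne' hq0
  -- D is continuous also at the zeros of u, although log u is singular there; this is what allows
  -- the passage to the limit below.
  let D : X → ℂ → ℝ := fun c z => H.chernDensity S c z + H.chernDensity I c z -
    H.chernDensity (HolomorphicSubbundle.whole r E) c z
  have hDc : ∀ c, ContinuousOn (D c) (chartAt ℂ c).target := fun c =>
    ((continuousOn_chernDensity H S c).add (continuousOn_chernDensity H I c)).sub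
      (continuousOn_chernDensity H _ c)
  have hD : ∀ c, ∀ z ∈ (chartAt ℂ c).target, 0 < u (chartInv c z) →
      D c z = -(1 / (4 * Real.pi)) * Δ (fun z' => Real.log (u (chartInv c z'))) z := by
    intro c z hz hpos
    have hfI : IsHolomorphicFrameOn r I.fibre (A (chartInv c z)).w (A (chartInv c z)).U :=
      ⟨(A _).isOpen, (A _).holomorphic_w, (A _).indep_w, fun q hq => by
        rw [hI, (A _).satFibre_range hkl hq]⟩
    have hfS : IsHolomorphicFrameOn r S.fibre (A (chartInv c z)).u (A (chartInv c z)).U :=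
      ⟨(A _).isOpen, (A _).holomorphic_u, fun q hq => (A _).indep_u hq, fun q hq => by
        rw [hS, (A _).satFibre_ker hkl hq]⟩
    have h1 := AdaptedFrame.chernDensity_add_sub H hkl hz (A (chartInv c z)) hfI hfS hpos
    have hev : (fun z' => Real.log (u (chartInv c z'))) =ᶠ[𝓝 z]
        fun z' => Real.log ((A (chartInv c z)).ratio H (chartInv c z')) := by
      filter_upwards [((chartAt ℂ c).continuousAt_symm hz).eventually
        ((A (chartInv c z)).isOpen.mem_nhds (A (chartInv c z)).mem)] with z' hz'
      rw [hu _ _ hz']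
    rw [(InnerProductSpace.laplacian_congr_nhds hev).eq_of_nhds]
    exact h1
  have hdeg : S.degree + I.degree - (HolomorphicSubbundle.whole r E).degree =
      ∑ c ∈ partitionIndex X, ∫ z in (chartAt ℂ c).target,
        partition X c (chartInv c z) * D c z := by
    simp only [HolomorphicSubbundle.degree, surfaceIntegral_eq_sum, ← Finset.sum_add_distrib,
      ← Finset.sum_sub_distrib, ← hH]
    refine Finset.sum_congr rfl fun c _ => ?_
    have i1 := integrableOn_partition_mul (continuousOn_chernDensity H S c)
    have i2 := integrableOn_partition_mul (continuousOn_chernDensity H I c)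
    have i3 := integrableOn_partition_mul
      (continuousOn_chernDensity H (HolomorphicSubbundle.whole r E) c)
    have i12 : IntegrableOn (fun z => partition X c (chartInv c z) * H.chernDensity S c z +
      partition X c (chartInv c z) * H.chernDensity I c z) (chartAt ℂ c).target := i1.add i2
    rw [← integral_add i1 i2, ← integral_sub i12 i3]
    refine integral_congr_ae (Eventually.of_forall fun z => ?_)
    simp only [D]
    ring
  let ε : ℕ → ℝ := fun n => 1 / ((n : ℝ) + 1)
  have hε : ∀ n, 0 < ε n := fun n => by positivity
  have huc : ∀ c : X, ContinuousOn (fun z => u (chartInv c z)) (chartAt ℂ c).target := fun c =>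
    hus.continuous.comp_continuousOn (chartAt ℂ c).continuousOn_symm
  have hGc : ∀ n c, ContinuousOn (fun z => u (chartInv c z) / (u (chartInv c z) + ε n) * D c z)
      (chartAt ℂ c).target := fun n c =>
    ((huc c).div ((huc c).add continuousOn_const)
      fun z _ => (add_pos_of_nonneg_of_pos (hu0 _) (hε n)).ne').mul (hDc c)
  -- The weighted density dominates -(1/4π) Δ log(u + ε), whose integral over X is zero.
  have hnonneg : ∀ n, 0 ≤ ∑ c ∈ partitionIndex X, ∫ z in (chartAt ℂ c).target,
      partition X c (chartInv c z) *
        (u (chartInv c z) / (u (chartInv c z) + ε n) * D c z) := by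
    intro n
    have hF : ContMDiff 𝓘(ℝ, ℂ) 𝓘(ℝ, ℝ) ∞ (fun p => Real.log (u p + ε n)) := fun p =>
      ContMDiffAt.comp (f := fun p => u p + ε n) p
        (Real.contDiffAt_log.2 (add_pos_of_nonneg_of_pos (hu0 p) (hε n)).ne').contMDiffAt
        ((hus p).add contMDiffAt_const)
    have h0 := surfaceIntegral_laplacian hF
    rw [surfaceIntegral_eq_sum] at h0
    have h1 : 0 = ∑ c ∈ partitionIndex X, ∫ z in (chartAt ℂ c).target,
        -(1 / (4 * Real.pi)) * (partition X c (chartInv c z) *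
          Δ ((fun p => Real.log (u p + ε n)) ∘ chartInv c) z) := by
      simp only [integral_const_mul, ← Finset.mul_sum, h0, mul_zero]
    rw [h1]
    refine Finset.sum_le_sum fun c _ => ?_
    refine setIntegral_mono_on
      ((integrableOn_partition_mul (continuousOn_laplacian_comp_chartInv c hF)).const_mul _)
      (integrableOn_partition_mul (hGc n c)) (chartAt ℂ c).open_target.measurableSet fun z hz => ?_
    have hρ : 0 ≤ partition X c (chartInv c z) := (partition X).nonneg c _
    have hc : 0 < 1 / (4 * Real.pi) := by positivity
    have huz : ContDiffAt ℝ 2 (fun z => u (chartInv c z)) z :=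
      (contDiffAt_comp_chartInv hz (hus _)).of_le two_le_infty
    have key : -(1 / (4 * Real.pi)) * Δ ((fun p => Real.log (u p + ε n)) ∘ chartInv c) z ≤
        u (chartInv c z) / (u (chartInv c z) + ε n) * D c z := by
      -- Where u > 0 this is the comparison of Laplacians. At a zero of u the right side is 0, and
      -- log(u + ε) has a minimum, so its Laplacian is nonnegative.
      rcases (hu0 (chartInv c z)).lt_or_eq with hpos | hzero
      · rw [hD c z hz hpos, mul_left_comm, neg_mul, neg_mul, neg_le_neg_iff]
        exact mul_le_mul_of_nonneg_left (laplacian_log_add_ge (hε n) huz hpos) hc.le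
      · rw [← hzero, zero_div, zero_mul, neg_mul, neg_nonpos]
        refine mul_nonneg hc.le (laplacian_nonneg_of_isLocalMin
          ((contDiffAt_comp_chartInv hz (hF _)).of_le two_le_infty)
          (Eventually.of_forall fun z' => ?_))
        simp only [Function.comp_apply, ← hzero, zero_add]
        exact Real.log_le_log (hε n) (by linarith [hu0 (chartInv c z')])
    calc _ = partition X c (chartInv c z) *
          (-(1 / (4 * Real.pi)) * Δ ((fun p => Real.log (u p + ε n)) ∘ chartInv c) z) := by ring
      _ ≤ _ := mul_le_mul_of_nonneg_left key hρ
  -- The factors u/(u + ε) lie in [0, 1] and tend to 1 off the finite, hence null, zero set of u.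
  have hlim : Tendsto (fun n => ∑ c ∈ partitionIndex X, ∫ z in (chartAt ℂ c).target,
      partition X c (chartInv c z) * (u (chartInv c z) / (u (chartInv c z) + ε n) * D c z)) atTop
      (𝓝 (∑ c ∈ partitionIndex X, ∫ z in (chartAt ℂ c).target,
        partition X c (chartInv c z) * D c z)) := by
    refine tendsto_finsetSum _ fun c _ => ?_
    refine tendsto_integral_of_dominated_convergence
      (fun z => ‖partition X c (chartInv c z) * D c z‖)
      (fun n => (integrableOn_partition_mul (hGc n c)).aestronglyMeasurable)
      (integrableOn_partition_mul (hDc c)).norm (fun n => ?_) ?_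
    · refine Eventually.of_forall fun z => ?_
      have hpos := add_pos_of_nonneg_of_pos (hu0 (chartInv c z)) (hε n)
      have h1 : ‖u (chartInv c z) / (u (chartInv c z) + ε n)‖ ≤ 1 := by
        rw [Real.norm_of_nonneg (div_nonneg (hu0 _) hpos.le), div_le_one hpos]
        linarith [hε n]
      rw [mul_left_comm, norm_mul]
      exact mul_le_of_le_one_left (norm_nonneg _) h1
    · rw [ae_restrict_iff' (chartAt ℂ c).open_target.measurableSet]
      have hnull : volume (chartAt ℂ c '' {p | u p = 0}) = 0 := (hZ.image _).measure_zero _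
      filter_upwards [compl_mem_ae_iff.2 hnull] with z hz hzT
      have hne : u (chartInv c z) ≠ 0 := fun h => hz ⟨_, h, (chartAt ℂ c).right_inv hzT⟩
      have h1 : Tendsto ε atTop (𝓝 0) := tendsto_one_div_add_atTop_nhds_zero_nat
      have h2 : Tendsto (fun n => u (chartInv c z) / (u (chartInv c z) + ε n)) atTop (𝓝 1) := by
        have h3 : Tendsto (fun n => u (chartInv c z) / (u (chartInv c z) + ε n)) atTop
            (𝓝 (u (chartInv c z) / (u (chartInv c z) + 0))) :=
          tendsto_const_nhds.div (h1.const_add (u (chartInv c z))) (by simpa using hne)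
        rwa [add_zero, div_self hne] at h3
      simpa using (h2.mul_const (D c z)).const_mul (partition X c (chartInv c z))
  have := ge_of_tendsto' hlim hnonneg
  rw [← hdeg] at this
  linarith

end DegreeInequality


/-! ### Eigenvalues of endomorphisms -/

section Endomorphism

universe w

variable {X : Type*} [TopologicalSpace X] [ChartedSpace ℂ X] [IsManifold 𝓘(ℂ, ℂ) ω X]
  {r : ℕ} {E : X → Type w}
  [∀ p, AddCommGroup (E p)] [∀ p, Module ℂ (E p)] [∀ p, TopologicalSpace (E p)]
  [TopologicalSpace (TotalSpace (Fin r → ℂ) E)] [FiberBundle (Fin r → ℂ) E]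
  [VectorBundle ℂ (Fin r → ℂ) E] [ContMDiffVectorBundle ω (Fin r → ℂ) E 𝓘(ℂ, ℂ)]

omit [IsManifold 𝓘(ℂ, ℂ) ω X] in
theorem IsHolomorphicMap.sub_smul_id {f : FibreMap E E} (hf : IsHolomorphicMap r r f) (c : ℂ) :
    IsHolomorphicMap r r (fun p => f p - c • (LinearMap.id : E p →ₗ[ℂ] E p)) := by
  intro x
  let e := trivializationAt (Fin r → ℂ) E x.1
  have hx : x.1 ∈ e.baseSet := mem_baseSet_trivializationAt _ _ _
  have h1 := (e.contMDiffAt_iff (IM := modelC r) (IB := 𝓘(ℂ, ℂ)) (n := ω)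
    (f := FibreMap.total r r f) (x₀ := x) (e.mem_source.2 hx)).1 (hf x)
  have h2 := (e.contMDiffAt_iff (IM := modelC r) (IB := 𝓘(ℂ, ℂ)) (n := ω)
    (f := (id : TotalSpace (Fin r → ℂ) E → _)) (x₀ := x) (e.mem_source.2 hx)).1 contMDiffAt_id
  refine (e.contMDiffAt_iff (e.mem_source.2 hx)).2 ⟨h1.1, ?_⟩
  refine (h1.2.sub ((contDiff_const_smul c).contMDiff.contMDiffAt.comp x h2.2)
    ).congr_of_eventuallyEq ?_
  filter_upwards [e.open_source.mem_nhds (e.mem_source.2 hx)] with y hy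
  have hy' : y.1 ∈ coordSet r E x.1 := e.mem_source.1 hy
  simp only [FibreMap.total, Function.comp_apply, id_eq, LinearMap.sub_apply,
    LinearMap.smul_apply]
  refine (coordMap_apply hy' _).symm.trans ?_
  rw [map_sub, map_smul, coordMap_apply hy', coordMap_apply hy']
  rfl

/-- The determinant is invariant under conjugation, so near p it is that of the analytic coordinate
matrix. -/
theorem mdifferentiable_det {g : FibreMap E E} (hg : IsHolomorphicMap r r g) :
    MDifferentiable 𝓘(ℂ, ℂ) 𝓘(ℂ, ℂ) (fun p => LinearMap.det (g p)) := by
  intro p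
  have hp := mem_chart_source ℂ p
  have hp' : p ∈ coordSet r E p := mem_baseSet_trivializationAt (Fin r → ℂ) E p
  have hM := analyticAt_coordEnd hg hp hp'
  have hd : AnalyticAt ℂ (fun z => (LinearMap.toMatrix'
      (coordEnd r g p (chartInv p z) : (Fin r → ℂ) →ₗ[ℂ] (Fin r → ℂ))).det) (chartAt ℂ p p) := by
    simp only [Matrix.det_apply, Units.smul_def, zsmul_eq_mul]
    refine Finset.analyticAt_fun_sum _ fun σ _ => analyticAt_const.mul ?_
    refine Finset.analyticAt_fun_prod _ fun i _ => ?_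
    simp only [LinearMap.toMatrix'_apply]
    exact ((ContinuousLinearMap.proj (R := ℂ) (φ := fun _ : Fin r => ℂ) (σ i)).analyticAt _).comp
      (AnalyticAt.clm_apply' hM analyticAt_const)
  refine ((contMDiffAt_comp_chart hp hd).congr_of_eventuallyEq ?_).mdifferentiableAt (by simp)
  filter_upwards [(chartAt ℂ p).open_source.mem_nhds hp,
    (trivializationAt (Fin r → ℂ) E p).open_baseSet.mem_nhds hp'] with q hq hq'
  have h1 : coordEnd r g p (chartInv p (chartAt ℂ p q)) = coordEnd r g p q :=
    congrArg (coordEnd r g p) ((chartAt ℂ p).left_inv hq)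
  let e : E q ≃ₗ[ℂ] (Fin r → ℂ) := LinearEquiv.ofLinearMap (coordMap r E p q) (coordSymm r E p q)
    (LinearMap.ext (coordMap_coordSymm hq')) (LinearMap.ext (coordSymm_coordMap hq'))
  simp only [Function.comp_apply, h1, LinearMap.det_toMatrix']
  exact (LinearMap.det_conj (g q) e).symm

/-- The determinant of g is a holomorphic function on a compact connected surface, hence constant:
if it vanishes at p, it vanishes everywhere. -/
theorem ker_ne_bot_of_ker_ne_bot [CompactSpace X] [ConnectedSpace X] {g : FibreMap E E}
    (hg : IsHolomorphicMap r r g) {p : X} (hp : LinearMap.ker (g p) ≠ ⊥) (q : X) :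
    LinearMap.ker (g q) ≠ ⊥ := by
  have hfd := fun q => LinearEquiv.finiteDimensional (fibreEquiv r E q).symm
  have h0 : LinearMap.det (g p) = 0 := by
    by_contra h
    exact hp (LinearMap.ker_eq_bot.2 ((LinearMap.isUnit_iff_isUnit_det _).2 (Ne.isUnit h) |> fun h =>
      ((Module.End.isUnit_iff _).1 h).1))
  have h1 : LinearMap.det (g q) = 0 := by
    rw [← h0]
    exact (mdifferentiable_det hg).apply_eq_of_compactSpace q p
  exact (LinearMap.bot_lt_ker_of_det_eq_zero h1).ne'

omit [IsManifold 𝓘(ℂ, ℂ) ω X] [ContMDiffVectorBundle ω (Fin r → ℂ) E 𝓘(ℂ, ℂ)]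
  [VectorBundle ℂ (Fin r → ℂ) E] in
theorem HolomorphicSubbundle.finrank_fibre (S : HolomorphicSubbundle r E) (p : X) :
    Module.finrank ℂ (S.fibre p) = S.rank := by
  obtain ⟨U, s, hU, hs⟩ := S.exists_frame p
  rw [← hs.span_eq p hU, finrank_span_eq_card (hs.linearIndependent p hU), Fintype.card_fin]

end Endomorphism

/-! ### Invariance under forms -/

section Forms

universe w

theorem alternatingMap_two_apply {M N : Type*} [AddCommGroup M] [Module ℝ M] [AddCommGroup N]
    [Module ℝ N] (y : M [⋀^Fin 2]→ₗ[ℝ] N) (x w : M) (a b a' b' : ℝ) :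
    y ![a • x + b • w, a' • x + b' • w] = (a * b' - b * a') • y ![x, w] := by
  have hswap : ∀ x w : M, y ![x, w] = -y ![w, x] := by
    intro x w
    have h := y.map_swap ![w, x] (show (0 : Fin 2) ≠ 1 by decide)
    rw [← h]
    congr 1
    ext i
    fin_cases i <;> simp
  have hself : ∀ x : M, y ![x, x] = 0 := fun x =>
    y.map_eq_zero_of_eq ![x, x] (show ![x, x] 0 = ![x, x] 1 by simp)
      (show (0 : Fin 2) ≠ 1 by decide)
  have hl : ∀ (a b : ℝ) (z : M), y ![a • x + b • w, z] = a • y ![x, z] + b • y ![w, z] := by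
    intro a b z
    rw [y.map_vecCons_add, y.map_vecCons_smul, y.map_vecCons_smul]
  rw [hl, hswap x, hswap w, hl, hl, hself, hself, hswap w x]
  module

variable {X : Type*} [TopologicalSpace X] [ChartedSpace ℂ X] [IsManifold 𝓘(ℂ, ℂ) ω X]

theorem exists_eq_smul_coordField {p : X} (t : TangentSpace 𝓘(ℂ, ℂ) p) :
    ∃ a : ℂ, t = a • coordField p p := by
  let e := trivializationAt ℂ (TangentSpace 𝓘(ℂ, ℂ) : X → Type) p
  have hp : p ∈ e.baseSet := mem_baseSet_trivializationAt _ _ _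
  refine ⟨e.linearMapAt ℂ p t, ?_⟩
  have h1 : coordField p p = e.symmₗ ℂ p 1 := (e.symmₗ_apply hp 1).symm
  rw [h1, ← map_smul, smul_eq_mul, mul_one, e.symmₗ_linearMapAt hp]

variable {r r' : ℕ} {E E' : X → Type w}
  [∀ p, AddCommGroup (E p)] [∀ p, Module ℂ (E p)] [∀ p, TopologicalSpace (E p)]
  [TopologicalSpace (TotalSpace (Fin r → ℂ) E)] [FiberBundle (Fin r → ℂ) E]
  [∀ p, AddCommGroup (E' p)] [∀ p, Module ℂ (E' p)] [∀ p, TopologicalSpace (E' p)]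
  [TopologicalSpace (TotalSpace (Fin r' → ℂ) E')] [FiberBundle (Fin r' → ℂ) E']
  {K : ∀ p, Submodule ℂ (E p)} {K' : ∀ p, Submodule ℂ (E' p)}

/-- The coordinate field spans the tangent line at p, so it is enough to treat the coefficient of
dz, which is a continuous bundle map near p. -/
theorem satFibre_le_comap_oneForm {φ : OneForm E E'} (hφ : φ.IsSmooth r r')
    (hK : ∀ q t, K q ≤ (K' q).comap (φ q t)) (p : X) (t : TangentSpace 𝓘(ℂ, ℂ) p) :
    satFibre r K p ≤ (satFibre r' K' p).comap (φ p t) := by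
  have h := satFibre_le_comap (T := fun q => φ q (coordField p q)) (chart_source_mem_nhds ℂ p)
    (hφ p).continuousOn fun q => hK q _
  obtain ⟨a, rfl⟩ := exists_eq_smul_coordField t
  intro x hx
  rw [Submodule.mem_comap, map_smul]
  exact Submodule.smul_mem _ a (h hx)

/-- A real alternating 2-form on the tangent line is determined by its value on the real basis ∂/∂z,
I·∂/∂z; its value on any pair is a real determinant times that coefficient. -/
theorem satFibre_le_comap_twoForm {y : TwoForm E E'} (hy : y.IsSmooth r r')
    (hK : ∀ q t, K q ≤ (K' q).comap (y q t)) (p : X) (t : Fin 2 → TangentSpace 𝓘(ℂ, ℂ) p) :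
    satFibre r K p ≤ (satFibre r' K' p).comap (y p t) := by
  have h := satFibre_le_comap (T := fun q => y q ![coordField p q, Complex.I • coordField p q])
    (chart_source_mem_nhds ℂ p) (hy p).continuousOn fun q => hK q _
  obtain ⟨a, ha⟩ := exists_eq_smul_coordField (t 0)
  obtain ⟨b, hb⟩ := exists_eq_smul_coordField (t 1)
  have hsplit : ∀ c : ℂ, c • coordField p p =
      c.re • coordField p p + c.im • (Complex.I • coordField p p) := by
    intro c
    conv_lhs => rw [← Complex.re_add_im c, add_smul, mul_smul]
    rfl
  have ht : t = ![t 0, t 1] := by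
    ext i
    fin_cases i <;> rfl
  intro x hx
  rw [Submodule.mem_comap, ht, ha, hb, hsplit a, hsplit b, alternatingMap_two_apply]
  exact Submodule.smul_mem _ ((a.re * b.im - a.im * b.re : ℝ) : ℂ) (h hx)

end Forms

/-! ### Kernels and ranges of intertwined endomorphisms. -/

theorem ker_le_comap_of_comm {M N : Type*} [AddCommGroup M] [Module ℂ M] [AddCommGroup N]
    [Module ℂ N] {T : M →ₗ[ℂ] N} {g : M →ₗ[ℂ] M} {g' : N →ₗ[ℂ] N} (h : g' ∘ₗ T = T ∘ₗ g) :
    LinearMap.ker g ≤ (LinearMap.ker g').comap T := fun x hx => by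
  have h1 := LinearMap.congr_fun h x
  rw [Submodule.mem_comap, LinearMap.mem_ker]
  simpa [LinearMap.mem_ker.1 hx] using h1

theorem range_le_comap_of_comm {M N : Type*} [AddCommGroup M] [Module ℂ M] [AddCommGroup N]
    [Module ℂ N] {T : M →ₗ[ℂ] N} {g : M →ₗ[ℂ] M} {g' : N →ₗ[ℂ] N} (h : g' ∘ₗ T = T ∘ₗ g) :
    LinearMap.range g ≤ (LinearMap.range g').comap T := by
  rintro _ ⟨x, rfl⟩
  exact ⟨T x, LinearMap.congr_fun h x⟩

/-! ### Stable bundles are simple -/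

section Quiver

universe w

variable {X : Type*} [TopologicalSpace X] [ChartedSpace ℂ X] [IsManifold 𝓘(ℂ, ℂ) ω X]
  {V : Type*} [Quiver V] {r : V → ℕ} {E : V → X → Type w}
  [∀ v p, AddCommGroup (E v p)] [∀ v p, Module ℂ (E v p)] [∀ v p, TopologicalSpace (E v p)]
  [∀ v, TopologicalSpace (TotalSpace (Fin (r v) → ℂ) (E v))]
  [∀ v, FiberBundle (Fin (r v) → ℂ) (E v)]

theorem IsMorphism.sub_smul_id [∀ v, VectorBundle ℂ (Fin (r v) → ℂ) (E v)]
    [∀ v, ContMDiffVectorBundle ω (Fin (r v) → ℂ) (E v) 𝓘(ℂ, ℂ)]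
    {R : Rep r E} {f : ∀ v, FibreMap (E v) (E v)} (hf : IsMorphism R R f) (c : ℂ) :
    IsMorphism R R (fun v p => f v p - c • (LinearMap.id : E v p →ₗ[ℂ] E v p)) where
  holomorphic v := (hf.holomorphic v).sub_smul_id c
  comm_φ v p t := by
    rw [LinearMap.sub_comp, LinearMap.comp_sub, hf.comm_φ, LinearMap.smul_comp,
      LinearMap.comp_smul, LinearMap.id_comp, LinearMap.comp_id]
  comm_x a p := by
    rw [LinearMap.sub_comp, LinearMap.comp_sub, hf.comm_x, LinearMap.smul_comp,
      LinearMap.comp_smul, LinearMap.id_comp, LinearMap.comp_id]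
  comm_y a p t := by
    rw [LinearMap.sub_comp, LinearMap.comp_sub, hf.comm_y, LinearMap.smul_comp,
      LinearMap.comp_smul, LinearMap.id_comp, LinearMap.comp_id]

theorem IsMorphism.isSubbundle_ker {R : Rep r E} {g : ∀ v, FibreMap (E v) (E v)}
    (hg : IsMorphism R R g) {S : ∀ v, HolomorphicSubbundle (r v) (E v)}
    (hS : ∀ v, (S v).fibre = satFibre (r v) (fun q => LinearMap.ker (g v q))) :
    R.IsSubbundle S where
  map_φ v p t := by
    rw [hS]
    exact satFibre_le_comap_oneForm (R.φ_smooth v)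
      (fun q t => ker_le_comap_of_comm (hg.comm_φ v q t)) p t
  map_x {i j} a p := by
    rw [hS, hS]
    exact satFibre_le_comap (T := R.x a) univ_mem
      (R.x_holomorphic a).continuous.continuousOn fun q => ker_le_comap_of_comm (hg.comm_x a q)
  map_y {i j} a p t := by
    rw [hS, hS]
    exact satFibre_le_comap_twoForm (R.y_smooth a)
      (fun q t => ker_le_comap_of_comm (hg.comm_y a q t)) p t

theorem IsMorphism.isSubbundle_range {R : Rep r E} {g : ∀ v, FibreMap (E v) (E v)}
    (hg : IsMorphism R R g) {S : ∀ v, HolomorphicSubbundle (r v) (E v)}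
    (hS : ∀ v, (S v).fibre = satFibre (r v) (fun q => LinearMap.range (g v q))) :
    R.IsSubbundle S where
  map_φ v p t := by
    rw [hS]
    exact satFibre_le_comap_oneForm (R.φ_smooth v)
      (fun q t => range_le_comap_of_comm (hg.comm_φ v q t)) p t
  map_x {i j} a p := by
    rw [hS, hS]
    exact satFibre_le_comap (T := R.x a) univ_mem
      (R.x_holomorphic a).continuous.continuousOn fun q => range_le_comap_of_comm (hg.comm_x a q)
  map_y {i j} a p t := by
    rw [hS, hS]
    exact satFibre_le_comap_twoForm (R.y_smooth a)
      (fun q t => range_le_comap_of_comm (hg.comm_y a q t)) p t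

variable [Fintype V] [∀ v, VectorBundle ℂ (Fin (r v) → ℂ) (E v)]
  [∀ v, ContMDiffVectorBundle ω (Fin (r v) → ℂ) (E v) 𝓘(ℂ, ℂ)] [CompactSpace X] [T2Space X]

omit [Quiver V] in
/-- If the ranks of two subbundles add up to the rank of the bundle and their degrees to at least
its degree, then one of their slopes is at least the slope of the bundle. -/
theorem not_slope_lt_and_slope_lt {σ τ : V → ℝ} (hσ : ∀ v, 0 < σ v)
    {S I : ∀ v, HolomorphicSubbundle (r v) (E v)} (hrank : ∀ v, (I v).rank + (S v).rank = r v)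
    (hdeg : ∀ v, (HolomorphicSubbundle.whole (r v) (E v)).degree ≤ (S v).degree + (I v).degree)
    {v v' : V} (hS : (S v).rank ≠ 0) (hI : (I v').rank ≠ 0)
    (h1 : slope σ τ S < slope σ τ (fun v => HolomorphicSubbundle.whole (r v) (E v)))
    (h2 : slope σ τ I < slope σ τ (fun v => HolomorphicSubbundle.whole (r v) (E v))) : False := by
  have pos : ∀ (S : ∀ v, HolomorphicSubbundle (r v) (E v)) (v : V), (S v).rank ≠ 0 →
      0 < ∑ v, ((S v).rank : ℝ) := fun S v h =>
    Finset.sum_pos' (fun _ _ => Nat.cast_nonneg _)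
      ⟨v, Finset.mem_univ v, Nat.cast_pos.2 (Nat.pos_of_ne_zero h)⟩
  have pS := pos S v hS
  have pI := pos I v' hI
  have hr : ∀ v, ((HolomorphicSubbundle.whole (r v) (E v)).rank : ℝ) =
      (S v).rank + (I v).rank := fun v => by
    rw [← Nat.cast_add, add_comm, hrank v]
    rfl
  have hR : ∑ v, ((HolomorphicSubbundle.whole (r v) (E v)).rank : ℝ) =
      ∑ v, ((S v).rank : ℝ) + ∑ v, ((I v).rank : ℝ) := by
    rw [← Finset.sum_add_distrib]
    exact Finset.sum_congr rfl fun v _ => hr v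
  -- The degree inequalities may be summed because the weights σ are positive; the τ terms add up
  -- exactly, whatever their signs.
  have hN : ∑ v, σ v * (HolomorphicSubbundle.whole (r v) (E v)).degree +
      ∑ v, τ v * ((HolomorphicSubbundle.whole (r v) (E v)).rank : ℝ) ≤
      (∑ v, σ v * (S v).degree + ∑ v, τ v * ((S v).rank : ℝ)) +
      (∑ v, σ v * (I v).degree + ∑ v, τ v * ((I v).rank : ℝ)) := by
    simp only [← Finset.sum_add_distrib]
    refine Finset.sum_le_sum fun v _ => ?_
    have := mul_le_mul_of_nonneg_left (hdeg v) (hσ v).le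
    rw [hr v]
    linarith
  set μ := slope σ τ (fun v => HolomorphicSubbundle.whole (r v) (E v)) with hμ
  rw [slope, hR, eq_div_iff (by positivity)] at hμ
  rw [slope, div_lt_iff₀ pS] at h1
  rw [slope, div_lt_iff₀ pI] at h2
  linarith

end Quiver

end QbarBundle

theorem mainTheorem4 {X : Type*} [TopologicalSpace X] [ChartedSpace ℂ X]
    [IsManifold 𝓘(ℂ, ℂ) ω X] [CompactSpace X] [T2Space X] [ConnectedSpace X]
    {V : Type*} [Fintype V] [Quiver V]
    {r : V → ℕ} {E : V → X → Type*}
    [∀ v p, AddCommGroup (E v p)] [∀ v p, Module ℂ (E v p)] [∀ v p, TopologicalSpace (E v p)]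
    [∀ v, TopologicalSpace (TotalSpace (Fin (r v) → ℂ) (E v))]
    [∀ v, FiberBundle (Fin (r v) → ℂ) (E v)]
    [∀ v, VectorBundle ℂ (Fin (r v) → ℂ) (E v)]
    [∀ v, ContMDiffVectorBundle ω (Fin (r v) → ℂ) (E v) 𝓘(ℂ, ℂ)]
    (R : QbarBundle.Rep r E) (σ τ : V → ℝ) (hσ : ∀ v, 0 < σ v) (hR : R.IsStable σ τ) :
    R.IsSimple := by
  classical
  intro f hf
  -- If every bundle is zero there is no eigenvalue to choose, but every endomorphism is zero.
  by_cases hr : ∀ v, r v = 0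
  · refine ⟨0, fun v p => LinearMap.ext fun x => ?_⟩
    have := LinearEquiv.finiteDimensional (QbarBundle.fibreEquiv (r v) (E v) p).symm
    have : Subsingleton (E v p) := Module.finrank_zero_iff.1
      ((QbarBundle.finrank_fibre (r v) (E v) p).trans (hr v))
    exact Subsingleton.elim _ _
  push Not at hr
  obtain ⟨v₀, hv₀⟩ := hr
  obtain ⟨p₀⟩ := (inferInstance : Nonempty X)
  obtain ⟨c, hc⟩ : ∃ c, Module.End.HasEigenvalue (f v₀ p₀) c := by
    have := LinearEquiv.finiteDimensional (QbarBundle.fibreEquiv (r v₀) (E v₀) p₀).symm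
    have : Nontrivial (E v₀ p₀) := Module.nontrivial_of_finrank_pos (R := ℂ) (by
      rw [QbarBundle.finrank_fibre (r v₀) (E v₀) p₀]
      exact Nat.pos_of_ne_zero hv₀)
    exact Module.End.exists_eigenvalue _
  refine ⟨c, ?_⟩
  by_contra! hne
  obtain ⟨v₁, p₁, hne⟩ := hne
  have hg := hf.sub_smul_id c
  set g : ∀ v, QbarBundle.FibreMap (E v) (E v) :=
    fun v p => f v p - c • (LinearMap.id : E v p →ₗ[ℂ] E v p) with hgdef
  have hker : ∀ q, LinearMap.ker (g v₀ q) ≠ ⊥ := by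
    refine QbarBundle.ker_ne_bot_of_ker_ne_bot (hg.holomorphic v₀) (p := p₀) ?_
    obtain ⟨x, hx⟩ := hc.exists_hasEigenvector
    refine (Submodule.ne_bot_iff _).2 ⟨x, ?_, hx.2⟩
    rw [LinearMap.mem_ker, LinearMap.sub_apply, hx.apply_eq_smul]
    simp
  have hg1 : g v₁ p₁ ≠ 0 := sub_ne_zero.2 hne
  choose S I hS hI hrank hA using fun v => QbarBundle.exists_kernel_image (hg.holomorphic v)
  -- The kernel of g at p₀ may exceed the saturated kernel, so the rank is read off at a nearby
  -- point q ≠ p₀, where the two agree; this is why the kernel has to be nonzero at every point.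
  have hS0 : (S v₀).rank ≠ 0 := by
    obtain ⟨A⟩ := hA v₀ p₀
    have := QbarBundle.nhdsWithin_ne_neBot p₀
    obtain ⟨q, hq, hqp⟩ : ∃ q, q ∈ A.U ∧ q ≠ p₀ := ((eventually_nhdsWithin_of_eventually_nhds
      (A.isOpen.mem_nhds A.mem)).and (eventually_mem_nhdsWithin (a := p₀) (s := {p₀}ᶜ))).exists
    intro h
    refine hker q ?_
    rw [A.ker_eq (hrank v₀) hq hqp]
    have : IsEmpty (Fin (S v₀).rank) := by rw [h]; infer_instance
    rw [Set.range_eq_empty, Submodule.span_empty]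
  obtain ⟨A⟩ := hA v₁ p₁
  -- At p₁, where g ≠ 0, the saturated image contains the range of g and the saturated kernel lies
  -- in its kernel; so I is nonzero and S is proper.
  have hI1 : (I v₁).fibre p₁ ≠ ⊥ := fun h => by
    have h1 := A.range_le_satFibre (hrank v₁) A.mem
    rw [hI v₁] at h
    rw [h, le_bot_iff, LinearMap.range_eq_bot] at h1
    exact hg1 h1
  have hS1 : (S v₁).fibre p₁ ≠ ⊤ := fun h => by
    have h1 := A.satFibre_ker_le (hrank v₁) A.mem
    rw [hS v₁] at h
    rw [h, top_le_iff, LinearMap.ker_eq_top] at h1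
    exact hg1 h1
  have hI1r : (I v₁).rank ≠ 0 := fun h => hI1 (by
    have := LinearEquiv.finiteDimensional (QbarBundle.fibreEquiv (r v₁) (E v₁) p₁).symm
    rw [← Submodule.finrank_eq_zero (R := ℂ), (I v₁).finrank_fibre, h])
  have hSbot : (S v₀).fibre p₀ ≠ ⊥ := fun h => hS0 (by
    rw [← (S v₀).finrank_fibre p₀, h, finrank_bot])
  -- The ranks of S and I at v₀ add up to r v₀ and S has positive rank there, so I is proper.
  have hItop : (I v₀).fibre p₀ ≠ ⊤ := fun h => by
    have h1 := (I v₀).finrank_fibre p₀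
    rw [h, finrank_top, QbarBundle.finrank_fibre (r v₀) (E v₀) p₀] at h1
    have h2 := hrank v₀
    omega
  exact QbarBundle.not_slope_lt_and_slope_lt hσ hrank
    (fun v => QbarBundle.degree_whole_le (hg.holomorphic v) (hS v) (hI v) (hrank v) (hA v))
    hS0 hI1r
    (hR S (hg.isSubbundle_ker hS) ⟨v₀, p₀, hSbot⟩ ⟨v₁, p₁, hS1⟩)
    (hR I (hg.isSubbundle_range hI) ⟨v₁, p₁, hI1⟩ ⟨v₀, p₀, hItop⟩)
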